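/- Setting. Let $\mathcal V$ be a finite ground set. A function $f:2^{\mathcal V}\to\mathbb R_{\ge 0}$ is normalized if $f(\emptyset)=0$, monotone if $f(A)\le f(B)$ for $A\subseteq B$, and submodular if $f(A\cup\{e\})-f(A)\ge f(B\cup\{e\})-f(B)$ for all $A\subseteq B\subseteq\mathcal V$ and $e\notin B$. A sequence $\mathcal S$ of updates (insertions and deletions of elements of $\mathcal V$) is processed one update at a time; $V_t$ is the set of elements that have been inserted during the first $t$ updates and not deleted after their latest insertion ($V_0=\emptyset$). A (randomized) dynamic algorithm knows $\mathcal V$, $k$ and $\varepsilon$; it starts at time $0$ without having asked any query, then for each update it may ask oracle queries about arbitrary subsets of $\mathcal V$ and toss coins, and it holds a set $I_t$ at every time $t$. The adversary is oblivious: $f$ (and the matroid) and $\mathcal S$ are fixed in advance, independently of the random choices of the algorithm. The worst-case expected query complexity is at most $b$ if every single update is processed with at most $b$ oracle queries in expectation. Theorem. There is an absolute constant $C$ such that for every finite $\mathcal V$, every integer $k\ge 0$ and every $0<\varepsilon\le 1$ the following holds. (i) There is a randomized dynamic algorithm such that for every normalized monotone submodular $f:2^{\mathcal V}\to\mathbb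 R_{\ge0}$, given by an oracle for the values $f(A)$, every matroid $\mathcal M(\mathcal V,\mathcal I)$ of rank $k$, given by an independence oracle, and every sequence $\mathcal S$ of insertions and deletions: at every time $t$, for every outcome of the random choices, $I_t\subseteq V_t$, $I_t\in\mathcal I$ and $(4+\varepsilon)\,f(I_t)\ge \max\{f(J): J\subseteq V_t,\ J\in\mathcal I\}$; and the worst-case expected number of queries per update (to both oracles together) is at most $$C\,k\,\log(k+1)\,\log^3\!\big((k+1)/\varepsilon\big).$$ (ii) There is a randomized dynamic algorithm such that for every normalized monotone submodular $f:2^{\mathcal V}\to\mathbb R_{\ge0}$, given by an oracle for the values $f(A)$, and every sequence $\mathcal S$ of insertions and deletions: at every time $t$, for every outcome of the random choices, $I_t\subseteq V_t$, $|I_t|\le k$ and $(2+\varepsilon)\,f(I_t)\ge \max\{f(J): J\subseteq V_t,\ |J|\le k\}$; and the worst-case expected number of queries per update is at most $$C\,k\,\varepsilon^{-1}\log^2(k+1).$$ For $k\ge 2$ these bounds are $O(k\log k\,\log^3(k/\varepsilon))$ and $O(k\,\varepsilon^{-1}\log^2 k)$. -/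

import Mathlib

open scoped ENNReal

universe u

/-- A set function `f : 2^V → ℝ≥0` that is normalized, monotone and submodular
(nonnegativity follows from `f ∅ = 0` and monotonicity). -/
structure IsMonotoneSubmodular {V : Type u} [DecidableEq V] (f : Finset V → ℝ) : Prop where
  /-- normalization -/
  map_empty : f ∅ = 0
  /-- monotonicity -/
  mono : ∀ A B : Finset V, A ⊆ B → f A ≤ f B
  /-- diminishing marginal gains -/
  submodular : ∀ A B : Finset V, A ⊆ B → ∀ e : V, e ∉ B →
    f (insert e B) - f B ≤ f (insert e A) - f A

/-- A randomized computation with oracle access and with result in `α`. A query `q : Q` is answered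
by an element of `R q`; apart from queries, the computation may draw uniform samples from finite
sets, and everything else (the choice of the next step) is free of charge. -/
inductive OracleComp {Q : Type u} (R : Q → Type) (α : Type u) : Type u where
  /-- stop with result `a` -/
  | ret (a : α) : OracleComp R α
  /-- ask the query `q` and continue depending on the answer -/
  | query (q : Q) (next : R q → OracleComp R α) : OracleComp R α
  /-- draw a uniformly random element of `{0, …, n}` and continue depending on it -/
  | sample (n : ℕ) (next : Fin (n + 1) → OracleComp R α) : OracleComp R α

/-- The joint law of the result and of the number of oracle queries, for the oracle `O`. -/
noncomputable def OracleComp.run {Q : Type u} {R : Q → Type} {α : Type u} (O : ∀ q, R q) :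
    OracleComp R α → PMF (α × ℕ)
  | .ret a => PMF.pure (a, 0)
  | .query q next => (OracleComp.run O (next (O q))).map fun x => (x.1, x.2 + 1)
  | .sample n next =>
      (PMF.uniformOfFintype (Fin (n + 1))).bind fun i => OracleComp.run O (next i)

/-- An update of the dynamic set: insertion or deletion of one element. -/
inductive Update (V : Type u) : Type u where
  | insert (v : V) : Update V
  | delete (v : V) : Update V

/-- Effect of one update on the set of present elements. -/
def Update.apply {V : Type u} [DecidableEq V] (W : Finset V) : Update V → Finset V
  | .insert v => Insert.insert v W
  | .delete v => W.erase v

/-- The set of elements that are present after the updates in the list (starting from the empty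
set): those that have been inserted and not deleted after their latest insertion. -/
def liveSet {V : Type u} [DecidableEq V] (S : List (Update V)) : Finset V :=
  S.foldl Update.apply ∅

/-- A randomized dynamic algorithm over the ground set `V` with oracle interface `R`. It starts in a
fixed state, without having asked any query; an update is processed by an oracle computation that
produces the next state; the maintained solution is read off from the state without queries. -/
structure DynamicAlgorithm (V : Type u) {Q : Type u} (R : Q → Type) where
  /-- internal states (the memory) -/
  State : Type u
  /-- the initial state, at time `0` -/
  init : State
  /-- processing of one update -/
  update : State → Update V → OracleComp R State
  /-- the maintained solution -/
  output : State → Finset V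

namespace DynamicAlgorithm

/-- Law of the state after the updates in the list, which is fixed in advance (oblivious adversary),
for the oracle `O`. -/
noncomputable def stateAfter {V : Type u} {Q : Type u} {R : Q → Type}
    (alg : DynamicAlgorithm V R) (O : ∀ q, R q) (S : List (Update V)) : PMF alg.State :=
  S.foldl (fun p x => p.bind fun s => ((alg.update s x).run O).map Prod.fst) (PMF.pure alg.init)

/-- Expected number of oracle queries asked while the update `x` is processed, after the updates in
`S` have been processed. -/
noncomputable def expectedQueries {V : Type u} {Q : Type u} {R : Q → Type}
    (alg : DynamicAlgorithm V R) (O : ∀ q, R q) (S : List (Update V)) (x : Update V) : ℝ≥0∞ :=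
  ∑' s, alg.stateAfter O S s * ∑' y : alg.State × ℕ, (alg.update s x).run O y * (y.2 : ℝ≥0∞)

end DynamicAlgorithm

/-- `I` is an `a`-approximate solution of the problem of maximizing `f` over the feasible subsets
of `W`. -/
def IsApproxSolution {V : Type u} (f : Finset V → ℝ) (feasible : Finset V → Prop) (W : Finset V)
    (a : ℝ) (I : Finset V) : Prop :=
  I ⊆ W ∧ feasible I ∧ ∀ J : Finset V, J ⊆ W → feasible J → f J ≤ a * f I

/-- With the oracle `O`, the algorithm maintains an `a`-approximate solution along the sequence `S`:
at every time `t`, whatever the random choices were. -/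
def DynamicAlgorithm.Maintains {V : Type u} [DecidableEq V] {Q : Type u} {R : Q → Type}
    (alg : DynamicAlgorithm V R) (O : ∀ q, R q) (f : Finset V → ℝ) (feasible : Finset V → Prop)
    (a : ℝ) (S : List (Update V)) : Prop :=
  ∀ t : ℕ, t ≤ S.length → ∀ s ∈ (alg.stateAfter O (S.take t)).support,
    IsApproxSolution f feasible (liveSet (S.take t)) a (alg.output s)

/-- With the oracle `O`, the algorithm has worst-case expected query complexity at most `b` along
the sequence `S`: every single update is processed with at most `b` expected queries. -/
def DynamicAlgorithm.QueryComplexityLE {V : Type u} {Q : Type u} {R : Q → Type}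
    (alg : DynamicAlgorithm V R) (O : ∀ q, R q) (S : List (Update V)) (b : ℝ) : Prop :=
  ∀ (t : ℕ) (ht : t < S.length),
    alg.expectedQueries O (S.take t) (S[t]) ≤ ENNReal.ofReal b

/-- Answers of the value oracle: the query `A` is answered by a real number. -/
abbrev ValueAnswer (V : Type u) : Finset V → Type := fun _ => ℝ

/-- Queries in the matroid problem: to the value oracle or to the independence oracle. -/
inductive MatroidQuery (V : Type u) : Type u where
  /-- what is `f A`? -/
  | value (A : Finset V) : MatroidQuery V
  /-- is `A` independent? -/
  | indep (A : Finset V) : MatroidQuery V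

/-- Answers of the value and independence oracles. -/
abbrev MatroidAnswer (V : Type u) : MatroidQuery V → Type
  | .value _ => ℝ
  | .indep _ => Bool

open Classical in
/-- The oracle given by a set function `f` and a matroid `M`. -/
noncomputable def matroidOracle {V : Type u} (f : Finset V → ℝ) (M : Matroid V) :
    ∀ q : MatroidQuery V, MatroidAnswer V q
  | .value A => f A
  | .indep A => decide (M.Indep (A : Set V))

/-!
Randomness enters only through one uniformly random order of the ground set, drawn at the first
update. For this order, the data structure is a function of the present elements alone, so that an
oblivious adversary cannot correlate with it. Suppose that a process receives elements one by one,
rejects or accepts each of them, and never again accepts an element that it has rejected or accepted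
(`IsFilterProcess`). The structure (`levels`) lists the states reached and, for each of them, the
remaining elements that this state accepts; the first of these leads to the next state.

*Query complexity.* As an element accepted by some state is accepted by all earlier ones, an element
can be appended by binary search over the levels. The insertion or deletion of `v` affects only the
levels below one at which `v` comes first, and the elements of this level are the only ones that
have to be appended again (`process_spec`). Exchanging the priorities of `v` and `u` exchanges their
roles at a level that contains both (`conflicts_le_conflicts_swap`); so, in a random order, the
expected number of elements to be appended again is at most the number of levels
(`sum_rebuildSize_le`).

*Cardinality constraint.* For each guess of the optimal value up to a factor `1 + ε / 2`, the
process accepts an element if there is room and if it gains at least the `2 * k`-th part of the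
guess. Either the solution is filled up, or the elements of an optimal solution together gain at
most half the optimum over it. An element takes part only in the processes for which its value is
between the threshold and the guess (`guessWindow`), which are `O(log k / ε)` many, and there are at
most `k + 1` levels.

*Matroid constraint.* Gains are taken over the set `A` of all elements accepted so far, and an
accepted element has its gain as its weight for ever. It is added to the solution `I`, or it
replaces the lightest element of the circuit that it closes in `I` if it has at least twice its
weight. Then `w(I) ≤ f(I)` by submodularity, and `f(A) ≤ 2 w(I)` since weights double at exchanges.
At the end, each element `v` of an independent set `J` outside `A` has small gain or depends on
elements of `I` of weight more than half its gain; by Hall's theorem, the gains of the latter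
elements sum up to at most `2 w(I)` (`sum_le_two_mul_sum_weight`), whence `f(J) ≤ 4 w(I)` up to the
small gains (`le_four_mul_value`). A rejected element stays rejected, because an exchange only
enlarges the span of the elements above a given weight (`Rejects.accept`). There are
`O(k log (k / ε))` levels, by a potential that grows with each acceptance (`Inv.accept`).

In both cases the best solution among all guesses is returned, measured by a lower bound of its
value that the processes know without further queries (`isApproxSolution_bestSolution`).
-/

universe v w

/-! ### Deterministic query algorithms -/

/-- A deterministic query algorithm with result in `α`, counting only its oracle queries. In
contrast to `OracleComp`, the result type may live in any universe, so that numbers and truth values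
can be intermediate results. -/
inductive DecisionTree {Q : Type u} (R : Q → Type) (α : Type v) : Type (max u v) where
  | ret (a : α) : DecisionTree R α
  | ask (q : Q) (next : R q → DecisionTree R α) : DecisionTree R α

namespace DecisionTree

variable {Q : Type u} {R : Q → Type} {α : Type v} {β : Type w}

/-- The result for the oracle `O`. -/
def eval (O : ∀ q, R q) : DecisionTree R α → α
  | ret a => a
  | ask q next => (next (O q)).eval O

/-- The number of queries asked for the oracle `O`. -/
def cost (O : ∀ q, R q) : DecisionTree R α → ℕ
  | ret _ => 0
  | ask q next => (next (O q)).cost O + 1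

/-- Sequential composition. -/
def bind : DecisionTree R α → (α → DecisionTree R β) → DecisionTree R β
  | ret a, g => g a
  | ask q next, g => ask q fun r => (next r).bind g

@[simp] theorem eval_ret (O : ∀ q, R q) (a : α) : (ret a : DecisionTree R α).eval O = a := rfl

@[simp] theorem cost_ret (O : ∀ q, R q) (a : α) : (ret a : DecisionTree R α).cost O = 0 := rfl

@[simp] theorem eval_ask (O : ∀ q, R q) (q : Q) (next : R q → DecisionTree R α) :
    (ask q next).eval O = (next (O q)).eval O := rfl

@[simp] theorem cost_ask (O : ∀ q, R q) (q : Q) (next : R q → DecisionTree R α) :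
    (ask q next).cost O = (next (O q)).cost O + 1 := rfl

@[simp] theorem eval_bind (O : ∀ q, R q) (t : DecisionTree R α) (g : α → DecisionTree R β) :
    (t.bind g).eval O = (g (t.eval O)).eval O := by
  induction t with
  | ret a => rfl
  | ask q next ih => exact ih _

@[simp] theorem cost_bind (O : ∀ q, R q) (t : DecisionTree R α) (g : α → DecisionTree R β) :
    (t.bind g).cost O = t.cost O + (g (t.eval O)).cost O := by
  induction t with
  | ret a => simp [bind]
  | ask q next ih => simp [bind, ih]; omega

/-- A deterministic query algorithm as an oracle computation. -/
def toComp {α : Type u} : DecisionTree R α → OracleComp R α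
  | ret a => .ret a
  | ask q next => .query q fun r => (next r).toComp

theorem run_toComp {α : Type u} (O : ∀ q, R q) (t : DecisionTree R α) :
    t.toComp.run O = PMF.pure (t.eval O, t.cost O) := by
  induction t with
  | ret a => simp [toComp, OracleComp.run]
  | ask q next ih => simp [toComp, OracleComp.run, ih, PMF.pure_map]

/-- Binary search in `{a, …, a + n - 1}` for the first index at which the antitone predicate decided
by `p` fails; the result is `a + n` if there is none. -/
def binarySearch (p : ℕ → DecisionTree R Bool) (a n : ℕ) : DecisionTree R ℕ :=
  if n = 0 then ret a
  else (p (a + n / 2)).bind fun b =>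
    if b then binarySearch p (a + n / 2 + 1) (n - n / 2 - 1) else binarySearch p a (n / 2)
termination_by n
decreasing_by all_goals omega

theorem cost_binarySearch_le (O : ∀ q, R q) (p : ℕ → DecisionTree R Bool) (c s : ℕ) :
    ∀ a n : ℕ, (∀ i < a + n, (p i).cost O ≤ c) → n < 2 ^ s →
      (binarySearch p a n).cost O ≤ c * s := by
  induction s with
  | zero =>
    intro a n _ hn
    have : n = 0 := by simpa using hn
    subst this
    rw [binarySearch]
    simp
  | succ s ih =>
    intro a n hc hn
    rw [binarySearch]
    split_ifs with h0
    · simp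
    · rw [pow_succ] at hn
      have h1 := hc (a + n / 2) (by omega)
      rw [cost_bind, mul_add, mul_one, add_comm]
      refine add_le_add ?_ h1
      split_ifs
      · exact ih _ _ (fun i hi => hc i (by omega)) (by omega)
      · exact ih _ _ (fun i hi => hc i (by omega)) (by omega)

theorem eval_binarySearch (O : ∀ q, R q) (p : ℕ → DecisionTree R Bool) (a n : ℕ)
    (hp : ∀ i j, a ≤ i → i ≤ j → j < a + n → (p j).eval O = true → (p i).eval O = true) :
    a ≤ (binarySearch p a n).eval O ∧ (binarySearch p a n).eval O ≤ a + n ∧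
      ∀ i, a ≤ i → i < a + n → ((p i).eval O = true ↔ i < (binarySearch p a n).eval O) := by
  induction n using Nat.strong_induction_on generalizing a with
  | _ n ih =>
    rw [binarySearch]
    split_ifs with h0
    · simp only [eval_ret]
      refine ⟨le_rfl, by omega, fun i h1 h2 => by omega⟩
    · rw [eval_bind]
      split_ifs with hb
      · obtain ⟨h1, h2, h3⟩ := ih (n - n / 2 - 1) (by omega) (a + n / 2 + 1)
          fun i j hi hij hj => hp i j (by omega) hij (by omega)
        refine ⟨by omega, by omega, fun i hi hi' => ?_⟩
        by_cases hm : i ≤ a + n / 2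
        · exact iff_of_true (hp i _ hi hm (by omega) hb) (by omega)
        · exact h3 i (by omega) (by omega)
      · obtain ⟨h1, h2, h3⟩ := ih (n / 2) (by omega) a
          fun i j hi hij hj => hp i j (by omega) hij (by omega)
        refine ⟨by omega, by omega, fun i hi hi' => ?_⟩
        by_cases hm : i < a + n / 2
        · exact h3 i (by omega) (by omega)
        · refine iff_of_false (fun h => hb (hp _ i (by omega) (by omega) (by omega) h)) (by omega)

end DecisionTree

/-! ### The level structure of a process in random order -/

/-- An incremental process on elements of `V`: in state `σ` the element `v` is either rejected
(`step σ v = none`) or accepted, with a new state. `Inv n σ` holds for states from which at most `n`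
further elements can be accepted; once an element has been rejected or accepted, it is rejected
ever after. -/
structure IsFilterProcess {V : Type u} {S : Type w} (step : S → V → Option S)
    (Inv : ℕ → S → Prop) : Prop where
  next : ∀ {n σ v σ'}, Inv n σ → step σ v = some σ' → ∃ m, n = m + 1 ∧ Inv m σ'
  reject_of_reject : ∀ {n σ v w σ'}, Inv n σ → step σ w = some σ' → step σ v = none →
    step σ' v = none
  reject_of_accept : ∀ {n σ v σ'}, Inv n σ → step σ v = some σ' → step σ' v = none

section Levels

variable {V : Type u} {S : Type w} {N : ℕ}

/-- `v` comes first in the set `A`, for the priorities `p`. -/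
def IsFirst (p : V ≃ Fin N) (v : V) (A : Finset V) : Prop :=
  v ∈ A ∧ ∀ u ∈ A, p v ≤ p u

instance [DecidableEq V] (p : V ≃ Fin N) (v : V) (A : Finset V) : Decidable (IsFirst p v A) :=
  inferInstanceAs (Decidable (_ ∧ _))

theorem IsFirst.eq {p : V ≃ Fin N} {v u : V} {A : Finset V} (hv : IsFirst p v A)
    (hu : IsFirst p u A) : v = u :=
  p.injective (le_antisymm (hv.2 u hu.1) (hu.2 v hv.1))

theorem exists_isFirst (p : V ≃ Fin N) {A : Finset V} (h : A.Nonempty) : ∃ v, IsFirst p v A :=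
  A.exists_min_image p h

theorem IsFirst.swap [DecidableEq V] {p : V ≃ Fin N} {v u : V} {A : Finset V}
    (hv : IsFirst p v A) (hu : u ∈ A) :
    IsFirst ((Equiv.swap u v).trans p) u A := by
  refine ⟨hu, fun w hw => ?_⟩
  simp only [Equiv.trans_apply, Equiv.swap_apply_left]
  refine hv.2 _ ?_
  rw [Equiv.swap_apply_def]
  split_ifs
  exacts [hv.1, hu, hw]

theorem IsFirst.swap_of_ne [DecidableEq V] {p : V ≃ Fin N} {v u e : V} {A : Finset V}
    (he : IsFirst p e A) (hu : u ∈ A) (hv : v ∈ A) (heu : e ≠ u) (hev : e ≠ v) :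
    IsFirst ((Equiv.swap u v).trans p) e A := by
  refine ⟨he.1, fun w hw => ?_⟩
  simp only [Equiv.trans_apply, Equiv.swap_apply_of_ne_of_ne heu hev]
  refine he.2 _ ?_
  rw [Equiv.swap_apply_def]
  split_ifs
  exacts [hv, hu, hw]

variable (step : S → V → Option S) (p : V ≃ Fin N)

/-- The elements of `A` that are accepted in state `σ`. -/
def accepted (σ : S) (A : Finset V) : Finset V :=
  A.filter fun v => (step σ v).isSome

theorem accepted_subset (σ : S) (A : Finset V) : accepted step σ A ⊆ A :=
  Finset.filter_subset _ _

theorem accepted_accepted (σ : S) (A : Finset V) :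
    accepted step σ (accepted step σ A) = accepted step σ A := by
  simp [accepted, Finset.filter_filter]

variable {step} in
theorem mem_accepted {σ : S} {A : Finset V} {v : V} :
    v ∈ accepted step σ A ↔ v ∈ A ∧ (step σ v).isSome :=
  Finset.mem_filter

/-- The state reached at the end of a level structure; `σ₀` for the empty list. -/
def finalState (σ₀ : S) (L : List (S × Finset V)) : S :=
  (L.getLast?.map Prod.fst).getD σ₀

theorem finalState_cons (σ₀ : S) (x y : S × Finset V) (L : List (S × Finset V)) :
    finalState σ₀ (x :: y :: L) = finalState σ₀ (y :: L) := by
  simp [finalState, List.getLast?_cons_cons]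

variable [DecidableEq V]

/-- The level structure of the process that starts in state `σ` and receives the elements of `A` in
the order of the priorities `p`: for each state reached, this state and the set of those remaining
elements that it accepts. The first of these elements is the one that leads to the next state. -/
noncomputable def levels (σ : S) (A : Finset V) : List (S × Finset V) :=
  (σ, accepted step σ A) ::
    if h : (accepted step σ A).Nonempty then
      levels ((step σ (exists_isFirst p h).choose).getD σ)
        ((accepted step σ A).erase (exists_isFirst p h).choose)
    else []
termination_by A.card
decreasing_by
  exact (Finset.card_erase_lt_of_mem (exists_isFirst p h).choose_spec.1).trans_le
    (Finset.card_le_card (accepted_subset step σ A))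

variable {step p}

theorem levels_of_empty {σ : S} {A : Finset V} (h : accepted step σ A = ∅) :
    levels step p σ A = [(σ, ∅)] := by
  rw [levels]
  simp [h]

theorem levels_of_isFirst {σ σ' : S} {A : Finset V} {e : V}
    (he : IsFirst p e (accepted step σ A)) (hs : step σ e = some σ') :
    levels step p σ A =
      (σ, accepted step σ A) :: levels step p σ' ((accepted step σ A).erase e) := by
  rw [levels]
  have h : (accepted step σ A).Nonempty := ⟨e, he.1⟩
  rw [dif_pos h, (exists_isFirst p h).choose_spec.eq he, hs]
  rfl

theorem levels_congr {σ : S} {A B : Finset V} (h : accepted step σ A = accepted step σ B) :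
    levels step p σ A = levels step p σ B := by
  rcases (accepted step σ A).eq_empty_or_nonempty with h0 | h0
  · rw [levels_of_empty h0, levels_of_empty (h ▸ h0)]
  · obtain ⟨e, he⟩ := exists_isFirst p h0
    obtain ⟨σ', hs⟩ := Option.isSome_iff_exists.1 (mem_accepted.1 he.1).2
    rw [levels_of_isFirst he hs, levels_of_isFirst (h ▸ he) hs, h]

variable (step p) in
/-- Induction along the levels. -/
theorem levels_induction {motive : S → Finset V → Prop}
    (empty : ∀ σ A, accepted step σ A = ∅ → motive σ A)
    (cons : ∀ σ A e σ', IsFirst p e (accepted step σ A) → step σ e = some σ' →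
      motive σ' ((accepted step σ A).erase e) → motive σ A) (σ : S) (A : Finset V) :
    motive σ A := by
  induction h : A.card using Nat.strong_induction_on generalizing σ A with
  | _ n ih =>
    rcases (accepted step σ A).eq_empty_or_nonempty with h0 | h0
    · exact empty σ A h0
    · obtain ⟨e, he⟩ := exists_isFirst p h0
      obtain ⟨σ', hs⟩ := Option.isSome_iff_exists.1 (mem_accepted.1 he.1).2
      refine cons σ A e σ' he hs (ih _ ?_ _ _ rfl)
      rw [← h]
      exact (Finset.card_erase_lt_of_mem he.1).trans_le
        (Finset.card_le_card (accepted_subset step σ A))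

theorem subset_of_mem_levels {σ : S} {A : Finset V} {x : S × Finset V}
    (hx : x ∈ levels step p σ A) : x.2 ⊆ A := by
  induction σ, A using levels_induction step p with
  | empty σ A h0 =>
    rw [levels_of_empty h0, List.mem_singleton] at hx
    simp [hx]
  | cons σ A e σ' he hs ih =>
    rw [levels_of_isFirst he hs, List.mem_cons] at hx
    rcases hx with rfl | hx
    · exact accepted_subset step σ A
    · exact (ih hx).trans ((Finset.erase_subset _ _).trans (accepted_subset step σ A))

section Inv

variable {Inv : ℕ → S → Prop} (hP : IsFilterProcess step Inv)
include hP

theorem levels_length_le {n : ℕ} {σ : S} {A : Finset V} (hI : Inv n σ) :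
    (levels step p σ A).length ≤ n + 1 := by
  induction σ, A using levels_induction step p generalizing n with
  | empty σ A h0 => simp [levels_of_empty h0]
  | cons σ A e σ' he hs ih =>
    obtain ⟨m, rfl, hm⟩ := hP.next hI hs
    rw [levels_of_isFirst he hs]
    simpa using ih hm

theorem inv_of_mem_levels {n : ℕ} {σ : S} {A : Finset V} {x : S × Finset V} (hI : Inv n σ)
    (hx : x ∈ levels step p σ A) : ∃ m, Inv m x.1 := by
  induction σ, A using levels_induction step p generalizing n with
  | empty σ A h0 =>
    rw [levels_of_empty h0, List.mem_singleton] at hx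
    exact ⟨n, by simpa [hx]⟩
  | cons σ A e σ' he hs ih =>
    rw [levels_of_isFirst he hs, List.mem_cons] at hx
    rcases hx with rfl | hx
    · exact ⟨n, hI⟩
    · obtain ⟨m, rfl, hm⟩ := hP.next hI hs
      exact ih hm hx

theorem reject_levels {n : ℕ} {σ : S} {A : Finset V} {v : V} {x : S × Finset V} (hI : Inv n σ)
    (hv : step σ v = none) (hx : x ∈ levels step p σ A) : step x.1 v = none := by
  induction σ, A using levels_induction step p generalizing n with
  | empty σ A h0 =>
    rw [levels_of_empty h0, List.mem_singleton] at hx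
    simpa [hx]
  | cons σ A e σ' he hs ih =>
    rw [levels_of_isFirst he hs, List.mem_cons] at hx
    rcases hx with rfl | hx
    · exact hv
    · obtain ⟨m, rfl, hm⟩ := hP.next hI hs
      exact ih hm (hP.reject_of_reject hI hs hv) hx

theorem accept_levels_antitone {n : ℕ} {σ : S} {A : Finset V} {v : V} (hI : Inv n σ) {i j : ℕ}
    (hij : i ≤ j) (hj : j < (levels step p σ A).length)
    (hv : (step ((levels step p σ A)[j]).1 v).isSome) :
    (step ((levels step p σ A)[i]).1 v).isSome := by
  induction σ, A using levels_induction step p generalizing n i j with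
  | empty σ A h0 =>
    have : j = 0 := by simpa [levels_of_empty h0] using hj
    obtain rfl : i = j := by omega
    exact hv
  | cons σ A e σ' he hs ih =>
    obtain ⟨m, rfl, hm⟩ := hP.next hI hs
    rcases i with _ | i
    · by_contra h
      have h : step σ v = none := by simpa [levels_of_isFirst he hs] using h
      rw [reject_levels hP hI h (List.getElem_mem hj)] at hv
      simp at hv
    · obtain ⟨j, rfl⟩ : ∃ j', j = j' + 1 := ⟨j - 1, by omega⟩
      simp only [levels_of_isFirst he hs, List.getElem_cons_succ] at hv ⊢
      exact ih hm (by omega) _ hv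

end Inv

theorem levels_ne_nil (σ : S) (A : Finset V) : levels step p σ A ≠ [] := by
  rw [levels]
  simp

theorem finalState_levels_of_empty {σ₀ σ : S} {A : Finset V} (h : accepted step σ A = ∅) :
    finalState σ₀ (levels step p σ A) = σ := by
  simp [levels_of_empty h, finalState]

theorem finalState_levels_of_isFirst {σ₀ σ σ' : S} {A : Finset V} {e : V}
    (he : IsFirst p e (accepted step σ A)) (hs : step σ e = some σ') :
    finalState σ₀ (levels step p σ A) =
      finalState σ₀ (levels step p σ' ((accepted step σ A).erase e)) := by
  rw [levels_of_isFirst he hs]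
  obtain ⟨y, L, h⟩ := List.exists_cons_of_ne_nil
    (levels_ne_nil (step := step) (p := p) σ' ((accepted step σ A).erase e))
  rw [h, finalState_cons]

theorem finalState_levels_induction {σ₀ σ : S} {A : Finset V} {J : S → Prop} (h0 : J σ)
    (hstep : ∀ σ v σ', v ∈ A → J σ → step σ v = some σ' → J σ') :
    J (finalState σ₀ (levels step p σ A)) := by
  induction σ, A using levels_induction step p with
  | empty σ A h => rwa [finalState_levels_of_empty h]
  | cons σ A e σ' he hs ih =>
    rw [finalState_levels_of_isFirst he hs]
    have heA := accepted_subset step σ A he.1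
    exact ih (hstep _ _ _ heA h0 hs) fun τ v τ' hv =>
      hstep τ v τ' (accepted_subset step σ A (Finset.mem_of_mem_erase hv))

theorem reject_finalState {Inv : ℕ → S → Prop} (hP : IsFilterProcess step Inv) {n : ℕ} {σ₀ σ : S}
    {A : Finset V} (hI : Inv n σ) {v : V} (hv : v ∈ A ∨ step σ v = none) :
    step (finalState σ₀ (levels step p σ A)) v = none := by
  induction σ, A using levels_induction step p generalizing n with
  | empty σ A h =>
    rw [finalState_levels_of_empty h]
    rcases hv with hv | hv
    · by_contra hne
      have : v ∈ accepted step σ A := mem_accepted.2 ⟨hv, Option.isSome_iff_ne_none.2 hne⟩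
      simp [h] at this
    · exact hv
  | cons σ A e σ' he hs ih =>
    rw [finalState_levels_of_isFirst he hs]
    obtain ⟨m, rfl, hm⟩ := hP.next hI hs
    refine ih hm ?_
    by_cases hr : step σ v = none
    · exact Or.inr (hP.reject_of_reject hI hs hr)
    · by_cases hve : v = e
      · subst hve
        exact Or.inr (hP.reject_of_accept hI hs)
      · refine Or.inl (Finset.mem_erase.2 ⟨hve, mem_accepted.2 ⟨?_, ?_⟩⟩)
        · exact hv.resolve_right hr
        · exact Option.isSome_iff_ne_none.2 hr

/-! ### The expected size of a rebuilt part -/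

variable (p) in
/-- The number of elements of the level at which `v` is the first element (`0` if there is no such
level): the size of the part of the level structure that depends on the presence of `v`. -/
def rebuildSize (v : V) (L : List (S × Finset V)) : ℕ :=
  (L.map fun x => if IsFirst p v x.2 then x.2.card else 0).sum

variable (p) in
/-- The number of levels (at most one) at which `v` is the first element and `u` is present. -/
def conflicts (v u : V) (L : List (S × Finset V)) : ℕ :=
  (L.map fun x => if IsFirst p v x.2 ∧ u ∈ x.2 then 1 else 0).sum

theorem rebuildSize_cons (v : V) (x : S × Finset V) (L : List (S × Finset V)) :
    rebuildSize p v (x :: L) = (if IsFirst p v x.2 then x.2.card else 0) + rebuildSize p v L := by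
  simp [rebuildSize]

theorem conflicts_cons (v u : V) (x : S × Finset V) (L : List (S × Finset V)) :
    conflicts p v u (x :: L) =
      (if IsFirst p v x.2 ∧ u ∈ x.2 then 1 else 0) + conflicts p v u L := by
  simp [conflicts]

theorem rebuildSize_eq_sum_conflicts (v : V) (A : Finset V) (L : List (S × Finset V))
    (hL : ∀ x ∈ L, x.2 ⊆ A) : rebuildSize p v L = ∑ u ∈ A, conflicts p v u L := by
  induction L with
  | nil => simp [rebuildSize, conflicts]
  | cons x L ih =>
    simp only [rebuildSize_cons, conflicts_cons, Finset.sum_add_distrib]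
    rw [ih fun y hy => hL y (List.mem_cons_of_mem _ hy)]
    congr 1
    by_cases h : IsFirst p v x.2
    · have : A.filter (fun u => u ∈ x.2) = x.2 := by
        rw [Finset.filter_mem_eq_inter, Finset.inter_eq_right]
        exact hL x List.mem_cons_self
      simp only [h, true_and, if_true, Finset.sum_boole, Nat.cast_id]
      rw [this]
    · simp [h]

theorem conflicts_eq_zero {v u : V} {L : List (S × Finset V)} (h : ∀ x ∈ L, v ∉ x.2 ∨ u ∉ x.2) :
    conflicts p v u L = 0 := by
  refine List.sum_eq_zero fun y hy => ?_
  obtain ⟨x, hx, rfl⟩ := List.mem_map.1 hy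
  refine if_neg fun hc => ?_
  exact (h x hx).elim (fun h => h hc.1.1) fun h => h hc.2

/-- Exchanging the priorities of `v` and `u` exchanges their roles: the process is the same up to
the level at which one of them comes first while both are present. -/
theorem conflicts_le_conflicts_swap (v u : V) (σ : S) (A : Finset V) :
    conflicts p v u (levels step p σ A) ≤
      conflicts ((Equiv.swap u v).trans p) u v
        (levels step ((Equiv.swap u v).trans p) σ A) := by
  rcases eq_or_ne u v with rfl | huv
  · simp
  induction σ, A using levels_induction step p with
  | empty σ A h =>
    rw [levels_of_empty h, conflicts_eq_zero]
    · exact Nat.zero_le _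
    · simp
  | cons σ A e σ' he hs ih =>
    by_cases hmem : v ∈ accepted step σ A ∧ u ∈ accepted step σ A
    · obtain ⟨hv, hu⟩ := hmem
      rw [levels_of_isFirst he hs, conflicts_cons]
      by_cases hev : e = v
      · subst hev
        have h1 := he.swap hu
        obtain ⟨τ, hτ⟩ := Option.isSome_iff_exists.1 (mem_accepted.1 hu).2
        rw [levels_of_isFirst h1 hτ, conflicts_cons, if_pos ⟨he, hu⟩, if_pos ⟨h1, hv⟩,
          conflicts_eq_zero fun x hx => Or.inl fun hm =>
            Finset.notMem_erase _ _ (subset_of_mem_levels hx hm)]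
        omega
      · have hnf : ¬ IsFirst p v (accepted step σ A) := fun h => hev (he.eq h)
        rw [if_neg fun h => hnf h.1, zero_add]
        by_cases heu : e = u
        · subst heu
          rw [conflicts_eq_zero fun x hx => Or.inr fun hm =>
            Finset.notMem_erase _ _ (subset_of_mem_levels hx hm)]
          exact Nat.zero_le _
        · rw [levels_of_isFirst (he.swap_of_ne hu hv heu hev) hs, conflicts_cons]
          exact ih.trans (Nat.le_add_left _ _)
    · have hz : ∀ x ∈ levels step p σ A, v ∉ x.2 ∨ u ∉ x.2 := by
        intro x hx
        by_contra! hcon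
        apply hmem
        have hsub : x.2 ⊆ accepted step σ A := by
          rw [levels_of_isFirst he hs, List.mem_cons] at hx
          rcases hx with rfl | hx
          · exact subset_rfl
          · exact (subset_of_mem_levels hx).trans (Finset.erase_subset _ _)
        exact ⟨hsub hcon.1, hsub hcon.2⟩
      rw [conflicts_eq_zero hz]
      exact Nat.zero_le _

/-- Each level has only one first element, and the last level has none. -/
theorem sum_conflicts_le {Inv : ℕ → S → Prop} (hP : IsFilterProcess step Inv) {n : ℕ} {σ : S}
    {A : Finset V} (hI : Inv n σ) (U : Finset V) (u : V) :
    ∑ v ∈ U, conflicts p v u (levels step p σ A) ≤ n := by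
  induction σ, A using levels_induction step p generalizing n with
  | empty σ A h =>
    rw [Finset.sum_eq_zero]
    · exact Nat.zero_le _
    · intro v _
      rw [levels_of_empty h, conflicts_eq_zero]
      simp
  | cons σ A e σ' he hs ih =>
    obtain ⟨m, rfl, hm⟩ := hP.next hI hs
    simp only [levels_of_isFirst he hs, conflicts_cons, Finset.sum_add_distrib]
    rw [add_comm]
    refine add_le_add (ih hm) ?_
    rw [Finset.sum_boole, Nat.cast_id, Finset.card_le_one]
    intro a ha b hb
    exact (Finset.mem_filter.1 ha).2.1.eq (Finset.mem_filter.1 hb).2.1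

/-- In a uniformly random order, the expected size of the part that depends on the presence of a
fixed element `v` is at most the number of levels. -/
theorem sum_rebuildSize_le [Fintype V] {Inv : ℕ → S → Prop} (hP : IsFilterProcess step Inv)
    {n : ℕ} {σ : S} (hI : Inv n σ) (A : Finset V) (v : V) :
    ∑ p : V ≃ Fin N, rebuildSize p v (levels step p σ A) ≤ Fintype.card (V ≃ Fin N) * n := by
  calc ∑ p : V ≃ Fin N, rebuildSize p v (levels step p σ A)
      = ∑ u ∈ A, ∑ p : V ≃ Fin N, conflicts p v u (levels step p σ A) := by
        rw [Finset.sum_comm]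
        exact Finset.sum_congr rfl fun p _ =>
          rebuildSize_eq_sum_conflicts v A _ fun x hx => subset_of_mem_levels hx
    _ ≤ ∑ u ∈ A, ∑ p : V ≃ Fin N, conflicts p u v (levels step p σ A) := by
        refine Finset.sum_le_sum fun u _ => ?_
        rw [← Equiv.sum_comp (Equiv.equivCongr (Equiv.swap u v) (Equiv.refl (Fin N)))
          fun p => conflicts p u v (levels step p σ A)]
        refine Finset.sum_le_sum fun p _ => ?_
        have : (Equiv.equivCongr (Equiv.swap u v) (Equiv.refl (Fin N))) p =
            (Equiv.swap u v).trans p := by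
          ext x; simp [Equiv.equivCongr]
        rw [this]
        exact conflicts_le_conflicts_swap v u σ A
    _ ≤ Fintype.card (V ≃ Fin N) * n := by
        rw [Finset.sum_comm, ← smul_eq_mul, ← Finset.card_univ]
        exact Finset.sum_le_card_nsmul _ _ _ fun p _ => sum_conflicts_le hP hI A v

end Levels

/-! ### Maintaining the level structure with few queries -/

section Maintenance

open DecisionTree

variable {Q : Type u} {R : Q → Type} {V : Type u} [DecidableEq V] {S : Type w} {N : ℕ}
  (tst : S → V → DecisionTree R (Option S)) (p : V ≃ Fin N)

/-- Does level `i` of `L` accept `v`? -/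
def probe (v : V) (L : List (S × Finset V)) (i : ℕ) : DecisionTree R Bool :=
  match L[i]? with
  | some x => (tst x.1 v).bind fun r => ret r.isSome
  | none => ret false

/-- Insertion of `v` into the first `j` levels of `L`, which are those that accept `v`. At the first
level at which `v` comes first, the remaining levels are replaced by the ones computed by `rb`. -/
def insertWalk (rb : S → Finset V → DecisionTree R (List (S × Finset V))) (v : V) :
    ℕ → List (S × Finset V) → DecisionTree R (List (S × Finset V))
  | 0, L => ret L
  | _ + 1, [] => ret []
  | j + 1, (σ, B) :: L =>
    if IsFirst p v (insert v B) then
      (tst σ v).bind fun r => (rb (r.getD σ) B).bind fun L' => ret ((σ, insert v B) :: L')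
    else (insertWalk rb v j L).bind fun L' => ret ((σ, insert v B) :: L')

/-- Insertion of `v` into a level structure, where the number of levels that accept `v` is found by
binary search. -/
def insertLevels (rb : S → Finset V → DecisionTree R (List (S × Finset V))) (v : V)
    (L : List (S × Finset V)) : DecisionTree R (List (S × Finset V)) :=
  (binarySearch (probe tst v L) 0 L.length).bind fun j => insertWalk tst p rb v j L

/-- Computation of a level structure, by appending the elements in the order of their priorities. -/
noncomputable def buildLevels (σ : S) (A : Finset V) : DecisionTree R (List (S × Finset V)) :=
  if h : A.Nonempty then
    (buildLevels σ (A.erase (A.exists_max_image p h).choose)).bind fun L =>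
      insertLevels tst p (fun s _ => ret [(s, ∅)]) (A.exists_max_image p h).choose L
  else ret [(σ, ∅)]
termination_by A.card
decreasing_by exact Finset.card_erase_lt_of_mem (A.exists_max_image p h).choose_spec.1

/-- Deletion of `v` from a level structure. -/
noncomputable def deleteLevels (v : V) :
    List (S × Finset V) → DecisionTree R (List (S × Finset V))
  | [] => ret []
  | (σ, B) :: L =>
    if v ∈ B then
      if IsFirst p v B then buildLevels tst p σ (B.erase v)
      else (deleteLevels v L).bind fun L' => ret ((σ, B.erase v) :: L')
    else ret ((σ, B) :: L)

variable {tst p} {O : ∀ q, R q} {Inv : ℕ → S → Prop} {c : ℕ}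

theorem accepted_insert_of_isSome {step : S → V → Option S} {σ : S} {A : Finset V} {v : V}
    (h : (step σ v).isSome) : accepted step σ (insert v A) = insert v (accepted step σ A) := by
  rw [accepted, Finset.filter_insert, if_pos h, accepted]

theorem accepted_insert_of_not {step : S → V → Option S} {σ : S} {A : Finset V} {v : V}
    (h : ¬ (step σ v).isSome) : accepted step σ (insert v A) = accepted step σ A := by
  rw [accepted, Finset.filter_insert, if_neg h, accepted]

/-- The walk turns the structure for `A` into the one for `insert v A`, provided that `rb` computes
the structures of sets whose elements come after `v`. -/
theorem insertWalk_spec (hP : IsFilterProcess (fun σ v => (tst σ v).eval O) Inv)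
    (hc : ∀ n σ v, Inv n σ → (tst σ v).cost O ≤ c) {n d j : ℕ} {σ : S} {A : Finset V} {v : V}
    {rb : S → Finset V → DecisionTree R (List (S × Finset V))}
    (hrb : ∀ m τ B, m ≤ n → Inv m τ → B ⊆ A → (∀ u ∈ B, p v ≤ p u) →
      (rb τ B).eval O = levels (fun σ v => (tst σ v).eval O) p τ B ∧
        (rb τ B).cost O ≤ d * B.card)
    (hv : v ∉ A) (hI : Inv n σ)
    (hj : ∀ (i : ℕ) (hi : i < (levels (fun σ v => (tst σ v).eval O) p σ A).length),
      ((tst ((levels (fun σ v => (tst σ v).eval O) p σ A)[i]).1 v).eval O).isSome ↔ i < j) :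
    (insertWalk tst p rb v j (levels (fun σ v => (tst σ v).eval O) p σ A)).eval O =
        levels (fun σ v => (tst σ v).eval O) p σ (insert v A) ∧
      (insertWalk tst p rb v j (levels (fun σ v => (tst σ v).eval O) p σ A)).cost O ≤
        c + d * rebuildSize p v (levels (fun σ v => (tst σ v).eval O) p σ (insert v A)) := by
  set step : S → V → Option S := fun σ v => (tst σ v).eval O with hstep
  -- the first level, at which `v` comes first
  have key : ∀ {n σ} {A : Finset V}, v ∉ A → Inv n σ → (step σ v).isSome →
      (∀ m τ B, m ≤ n → Inv m τ → B ⊆ A → (∀ u ∈ B, p v ≤ p u) →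
        (rb τ B).eval O = levels step p τ B ∧ (rb τ B).cost O ≤ d * B.card) →
      IsFirst p v (insert v (accepted step σ A)) →
      ∀ j L, (insertWalk tst p rb v (j + 1) ((σ, accepted step σ A) :: L)).eval O =
          levels step p σ (insert v A) ∧
        (insertWalk tst p rb v (j + 1) ((σ, accepted step σ A) :: L)).cost O ≤
          c + d * rebuildSize p v (levels step p σ (insert v A)) := by
    intro n σ A hv hI hs hrb hf j L
    obtain ⟨τ, hτ⟩ := Option.isSome_iff_exists.1 hs
    obtain ⟨m, rfl, hm⟩ := hP.next hI hτ
    have hvR : v ∉ accepted step σ A := fun h => hv (accepted_subset _ _ _ h)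
    have hacc := accepted_insert_of_isSome (A := A) hs
    rw [← hacc] at hf
    have hτ' : (tst σ v).eval O = some τ := hτ
    obtain ⟨h1, h2⟩ := hrb m τ (accepted step σ A) (by omega) hm (accepted_subset _ _ _)
      fun u hu => hf.2 u (hacc ▸ Finset.mem_insert_of_mem hu)
    rw [levels_of_isFirst hf hτ, rebuildSize_cons, if_pos hf, hacc, Finset.erase_insert hvR]
    rw [hacc] at hf
    simp only [insertWalk, if_pos hf, eval_bind, cost_bind, hτ', Option.getD_some, eval_ret,
      cost_ret, h1, add_zero, true_and]
    have h3 : (accepted step σ A).card ≤ (insert v (accepted step σ A)).card :=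
      Finset.card_le_card (Finset.subset_insert _ _)
    have h4 : d * (accepted step σ A).card ≤ d * ((insert v (accepted step σ A)).card +
        rebuildSize p v (levels step p τ (accepted step σ A))) :=
      Nat.mul_le_mul_left _ (by omega)
    exact add_le_add (hc _ _ _ hI) (h2.trans h4)
  have reject : ∀ {σ} {A : Finset V}, ¬ (step σ v).isSome → ∀ L, L = levels step p σ A →
      (insertWalk tst p rb v 0 L).eval O = levels step p σ (insert v A) ∧
      (insertWalk tst p rb v 0 L).cost O ≤
          c + d * rebuildSize p v (levels step p σ (insert v A)) := by
    rintro σ A hs L rfl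
    simp only [insertWalk, eval_ret, cost_ret]
    exact ⟨levels_congr (accepted_insert_of_not hs).symm, Nat.zero_le _⟩
  induction σ, A using levels_induction step p generalizing n j with
  | empty σ A h =>
    have hs : (step σ v).isSome ↔ 0 < j := by
      have := hj 0 (by simp [levels_of_empty h])
      simpa [levels_of_empty h] using this
    rcases j with _ | j
    · exact reject (by simpa using hs) _ rfl
    · rw [levels_of_empty h, ← h]
      refine key hv hI (by simpa using hs) hrb ?_ j []
      rw [h]
      exact ⟨by simp, by simp⟩
  | cons σ A e σ' he hs' ih =>
    have hs : (step σ v).isSome ↔ 0 < j := by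
      have := hj 0 (by simp [levels_of_isFirst he hs'])
      simpa [levels_of_isFirst he hs'] using this
    rcases j with _ | j
    · exact reject (by simpa using hs) _ rfl
    · have hs : (step σ v).isSome := by simpa using hs
      by_cases hf : IsFirst p v (insert v (accepted step σ A))
      · rw [levels_of_isFirst he hs']
        exact key hv hI hs hrb hf j _
      · obtain ⟨m, rfl, hm⟩ := hP.next hI hs'
        have hvR : v ∉ accepted step σ A := fun h => hv (accepted_subset _ _ _ h)
        have hacc := accepted_insert_of_isSome (A := A) hs
        have hev : p e ≤ p v := by
          by_contra! hlt
          refine hf ⟨Finset.mem_insert_self _ _, fun u hu => ?_⟩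
          rcases Finset.mem_insert.1 hu with rfl | hu
          · exact le_rfl
          · exact hlt.le.trans (he.2 u hu)
        have hne : e ≠ v := fun h => hvR (h ▸ he.1)
        have he' : IsFirst p e (accepted step σ (insert v A)) := by
          rw [hacc]
          refine ⟨Finset.mem_insert_of_mem he.1, fun u hu => ?_⟩
          rcases Finset.mem_insert.1 hu with rfl | hu
          · exact hev
          · exact he.2 u hu
        have hsub : (accepted step σ A).erase e ⊆ A :=
          (Finset.erase_subset _ _).trans (accepted_subset _ _ _)
        obtain ⟨h1, h2⟩ := ih (n := m) (j := j) (fun h => hv (hsub h)) hm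
          (fun l τ B hl hτ hB hu => hrb l τ B (by omega) hτ (hB.trans hsub) hu)
          (fun i hi => by
            have := hj (i + 1) (by simpa [levels_of_isFirst he hs'] using hi)
            simpa [levels_of_isFirst he hs'] using this)
        rw [levels_of_isFirst he hs', levels_of_isFirst he' hs', rebuildSize_cons, hacc,
          Finset.erase_insert_of_ne hne.symm]
        simp only [insertWalk, if_neg hf, eval_bind, cost_bind, eval_ret, cost_ret, h1, add_zero,
          true_and]
        simpa using h2

theorem insertLevels_spec (hP : IsFilterProcess (fun σ v => (tst σ v).eval O) Inv)
    (hc : ∀ n σ v, Inv n σ → (tst σ v).cost O ≤ c) {n d s : ℕ} {σ : S} {A : Finset V} {v : V}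
    {rb : S → Finset V → DecisionTree R (List (S × Finset V))}
    (hrb : ∀ m τ B, m ≤ n → Inv m τ → B ⊆ A → (∀ u ∈ B, p v ≤ p u) →
      (rb τ B).eval O = levels (fun σ v => (tst σ v).eval O) p τ B ∧
        (rb τ B).cost O ≤ d * B.card)
    (hv : v ∉ A) (hI : Inv n σ) (hs : n + 1 < 2 ^ s) :
    (insertLevels tst p rb v (levels (fun σ v => (tst σ v).eval O) p σ A)).eval O =
        levels (fun σ v => (tst σ v).eval O) p σ (insert v A) ∧
      (insertLevels tst p rb v (levels (fun σ v => (tst σ v).eval O) p σ A)).cost O ≤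
        c * (s + 1) +
          d * rebuildSize p v (levels (fun σ v => (tst σ v).eval O) p σ (insert v A)) := by
  set step : S → V → Option S := fun σ v => (tst σ v).eval O with hstep
  set L := levels step p σ A with hL
  have hprobe : ∀ (i : ℕ) (hi : i < L.length),
      (probe tst v L i).eval O = ((tst (L[i]).1 v).eval O).isSome := by
    intro i hi
    simp [probe, List.getElem?_eq_getElem hi]
  obtain ⟨-, -, h1⟩ := eval_binarySearch O (probe tst v L) 0 L.length (by
    intro i j _ hij hj hp
    rw [zero_add] at hj
    rw [hprobe j hj] at hp
    rw [hprobe i (hij.trans_lt hj)]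
    exact accept_levels_antitone hP hI hij hj hp)
  have h2 := cost_binarySearch_le O (probe tst v L) c s 0 L.length (by
    intro i hi
    rw [zero_add] at hi
    obtain ⟨m, hm⟩ := inv_of_mem_levels hP hI (List.getElem_mem hi)
    simpa [probe, List.getElem?_eq_getElem hi] using hc _ _ v hm)
    ((levels_length_le hP hI).trans_lt hs)
  obtain ⟨h3, h4⟩ := insertWalk_spec hP hc hrb hv hI
    (j := (binarySearch (probe tst v L) 0 L.length).eval O) (fun i hi => by
      rw [← hprobe i hi]
      exact h1 i (Nat.zero_le _) (by simpa using hi))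
  simp only [insertLevels, eval_bind, cost_bind]
  refine ⟨h3, ?_⟩
  rw [mul_add, mul_one, add_assoc]
  exact add_le_add h2 h4

theorem buildLevels_spec (hP : IsFilterProcess (fun σ v => (tst σ v).eval O) Inv)
    (hc : ∀ n σ v, Inv n σ → (tst σ v).cost O ≤ c) {n s : ℕ} {σ : S} (A : Finset V)
    (hI : Inv n σ) (hs : n + 1 < 2 ^ s) :
    (buildLevels tst p σ A).eval O = levels (fun σ v => (tst σ v).eval O) p σ A ∧
      (buildLevels tst p σ A).cost O ≤ c * (s + 1) * A.card := by
  induction h : A.card using Nat.strong_induction_on generalizing A with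
  | _ k ih =>
    rw [buildLevels]
    split_ifs with h0
    · obtain ⟨hv, hmax⟩ := (A.exists_max_image p h0).choose_spec
      set v := (A.exists_max_image p h0).choose with hvdef
      have hcard := Finset.card_erase_of_mem hv
      have hpos : 0 < A.card := Finset.card_pos.2 h0
      obtain ⟨h1, h2⟩ := ih _ (by omega) (A.erase v) hcard
      have hA : insert v (A.erase v) = A := Finset.insert_erase hv
      -- all other elements precede `v`, so nothing has to be rebuilt
      obtain ⟨h3, h4⟩ := insertLevels_spec hP hc (n := n) (d := 0) (p := p) (s := s) (σ := σ)
        (A := A.erase v) (v := v) (rb := fun s _ => ret [(s, ∅)]) (by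
          intro m τ B _ _ hB hlt
          have : B = ∅ := by
            refine Finset.eq_empty_of_forall_notMem fun u hu => ?_
            have huA := Finset.mem_erase.1 (hB hu)
            exact huA.1 (p.injective (le_antisymm (hmax u huA.2) (hlt u hu)))
          subst this
          rw [levels_of_empty (by simp [accepted])]
          simp) (Finset.notMem_erase _ _) hI hs
      rw [hA] at h3 h4
      simp only [eval_bind, cost_bind, h1]
      refine ⟨h3, (add_le_add h2 h4).trans (le_of_eq ?_)⟩
      obtain ⟨k', rfl⟩ : ∃ k', k = k' + 1 := ⟨k - 1, by omega⟩
      rw [h]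
      simp only [Nat.add_sub_cancel]
      ring
    · rw [Finset.not_nonempty_iff_eq_empty] at h0
      subst h0
      rw [levels_of_empty (by simp [accepted])]
      simp

theorem insertLevels_buildLevels_spec (hP : IsFilterProcess (fun σ v => (tst σ v).eval O) Inv)
    (hc : ∀ n σ v, Inv n σ → (tst σ v).cost O ≤ c) {n s : ℕ} {σ : S} {A : Finset V} {v : V}
    (hv : v ∉ A) (hI : Inv n σ) (hs : n + 1 < 2 ^ s) :
    (insertLevels tst p (buildLevels tst p) v
        (levels (fun σ v => (tst σ v).eval O) p σ A)).eval O =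
        levels (fun σ v => (tst σ v).eval O) p σ (insert v A) ∧
      (insertLevels tst p (buildLevels tst p) v
          (levels (fun σ v => (tst σ v).eval O) p σ A)).cost O ≤
        c * (s + 1) *
          (1 + rebuildSize p v (levels (fun σ v => (tst σ v).eval O) p σ (insert v A))) := by
  rw [mul_add, mul_one]
  exact insertLevels_spec hP hc
    (fun m τ B hm hτ _ _ => buildLevels_spec hP hc B hτ (by omega : m + 1 < 2 ^ s)) hv hI hs

theorem deleteLevels_spec (hP : IsFilterProcess (fun σ v => (tst σ v).eval O) Inv)
    (hc : ∀ n σ v, Inv n σ → (tst σ v).cost O ≤ c) {n s : ℕ} {σ : S} {A : Finset V} {v : V}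
    (hI : Inv n σ) (hs : n + 1 < 2 ^ s) :
    (deleteLevels tst p v (levels (fun σ v => (tst σ v).eval O) p σ A)).eval O =
        levels (fun σ v => (tst σ v).eval O) p σ (A.erase v) ∧
      (deleteLevels tst p v (levels (fun σ v => (tst σ v).eval O) p σ A)).cost O ≤
        c * (s + 1) * rebuildSize p v (levels (fun σ v => (tst σ v).eval O) p σ A) := by
  set step : S → V → Option S := fun σ v => (tst σ v).eval O with hstep
  have hacc : ∀ σ A, accepted step σ (A.erase v) = (accepted step σ A).erase v :=
    fun σ A => Finset.filter_erase _ _ _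
  induction σ, A using levels_induction step p generalizing n with
  | empty σ A h =>
    have h' : accepted step σ (A.erase v) = ∅ := by rw [hacc, h, Finset.erase_empty]
    rw [levels_of_empty h, levels_of_empty h']
    simp [deleteLevels]
  | cons σ A e σ' he hs' ih =>
    obtain ⟨m, rfl, hm⟩ := hP.next hI hs'
    by_cases hv : v ∈ accepted step σ A
    · by_cases hf : IsFirst p v (accepted step σ A)
      · rw [levels_of_isFirst he hs', rebuildSize_cons, if_pos hf]
        simp only [deleteLevels, if_pos hv, if_pos hf]
        obtain ⟨h1, h2⟩ := buildLevels_spec (p := p) hP hc ((accepted step σ A).erase v) hI hs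
        rw [h1]
        refine ⟨levels_congr ?_, h2.trans (Nat.mul_le_mul_left _ ?_)⟩
        · rw [← hacc, accepted_accepted]
        · exact (Finset.card_le_card (Finset.erase_subset _ _)).trans (Nat.le_add_right _ _)
      · obtain ⟨h1, h2⟩ := ih hm (by omega)
        have hev : e ≠ v := fun h => hf (h ▸ he)
        have he' : IsFirst p e (accepted step σ (A.erase v)) := by
          rw [hacc]
          exact ⟨Finset.mem_erase.2 ⟨hev, he.1⟩, fun u hu => he.2 u (Finset.mem_of_mem_erase hu)⟩
        rw [levels_of_isFirst he hs', levels_of_isFirst he' hs', rebuildSize_cons, if_neg hf]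
        simp only [deleteLevels, if_pos hv, if_neg hf, eval_bind, cost_bind, eval_ret, cost_ret,
          h1, hacc, zero_add, add_zero]
        exact ⟨by rw [Finset.erase_right_comm], h2⟩
    · have h1 : levels step p σ (A.erase v) = levels step p σ A :=
        levels_congr (by rw [hacc, Finset.erase_eq_of_notMem hv])
      rw [h1, levels_of_isFirst he hs']
      simp [deleteLevels, if_neg hv]

end Maintenance

/-! ### The dynamic algorithm -/

/-- A family of processes with a common initial state, indexed by guesses `i : ι` of the optimal
value. The elements `v` take part in the processes with indices in `guesses v`. Finally, `solution`
and `value` read off from a state a solution and a lower bound for its value. -/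
structure GuessedProcess {Q : Type u} (R : Q → Type) (V S : Type u) (ι : Type) where
  test : ι → S → V → DecisionTree R (Option S)
  guesses : V → DecisionTree R (Finset ι)
  start : S
  solution : S → Finset V
  value : S → ℝ

namespace GuessedProcess

open DecisionTree

variable {Q : Type u} {R : Q → Type} {V S : Type u} {ι : Type} (P : GuessedProcess R V S ι)
  (O : ∀ q, R q)

/-- The process of index `i` for the oracle `O`. -/
def step (i : ι) (σ : S) (v : V) : Option S := (P.test i σ v).eval O

/-- The processes do what they should: at most `T` elements can be accepted by each of them, each
test costs at most `c` queries, the guesses for one element cost at most `c₀` queries and there are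
at most `g` of them. -/
structure IsEfficient (Inv : ι → ℕ → S → Prop) (T c c₀ g : ℕ) : Prop where
  isFilterProcess : ∀ i, IsFilterProcess (P.step O i) (Inv i)
  start : ∀ i, Inv i T P.start
  cost_test : ∀ i n σ v, Inv i n σ → (P.test i σ v).cost O ≤ c
  cost_guesses : ∀ v, (P.guesses v).cost O ≤ c₀
  card_guesses : ∀ v, ((P.guesses v).eval O).card ≤ g

variable [DecidableEq V] [DecidableEq ι] {N : ℕ}

/-- The elements of `W` that take part in the process of index `i`. -/
def participants (W : Finset V) (i : ι) : Finset V :=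
  W.filter fun v => i ∈ (P.guesses v).eval O

/-- The level structures of all processes, for the order `p` and the present elements `W`. -/
noncomputable def structures (p : V ≃ Fin N) (W : Finset V) (i : ι) : List (S × Finset V) :=
  levels (P.step O i) p P.start (P.participants O W i)

/-- The memory of the dynamic algorithm, once it has drawn a random order: this order, the present
elements, and the level structures of all processes. -/
abbrev Memory (V S : Type u) (ι : Type) (N : ℕ) : Type u :=
  (V ≃ Fin N) × Finset V × (ι → List (S × Finset V))

/-- The memory that the dynamic algorithm is meant to have for the present elements `W`. -/
noncomputable def memory (W : Finset V) (p : V ≃ Fin N) : Memory V S ι N :=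
  (p, W, P.structures O p W)

/-- Apply the query algorithms `F i` to the components in the list. -/
def updateComponents {L : Type u} (F : ι → L → DecisionTree R L) :
    List ι → (ι → L) → DecisionTree R (ι → L)
  | [], D => ret D
  | i :: is, D => (F i (D i)).bind fun x => updateComponents F is (Function.update D i x)

theorem updateComponents_spec {L : Type u} (F : ι → L → DecisionTree R L) (is : List ι)
    (h : is.Nodup) (D : ι → L) :
    (updateComponents F is D).eval O =
        (fun i => if i ∈ is then (F i (D i)).eval O else D i) ∧
      (updateComponents F is D).cost O = (is.map fun i => (F i (D i)).cost O).sum := by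
  induction is generalizing D with
  | nil => simp [updateComponents]
  | cons i is ih =>
    rw [List.nodup_cons] at h
    obtain ⟨h1, h2⟩ := ih h.2 (Function.update D i ((F i (D i)).eval O))
    simp only [updateComponents, eval_bind, cost_bind, h1, h2, List.map_cons, List.sum_cons]
    constructor
    · funext j
      rcases eq_or_ne j i with rfl | hj
      · simp [h.1]
      · simp [hj]
    · congr 2
      refine List.map_congr_left fun j hj => ?_
      rw [Function.update_of_ne (by rintro rfl; exact h.1 hj)]

/-- Processing of one update. -/
noncomputable def process : Memory V S ι N → Update V → DecisionTree R (Memory V S ι N)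
  | (p, W, D), .insert v =>
    if v ∈ W then ret (p, W, D)
    else (P.guesses v).bind fun G =>
      (updateComponents (fun i => insertLevels (P.test i) p (buildLevels (P.test i) p) v)
        G.toList D).bind fun D' => ret (p, insert v W, D')
  | (p, W, D), .delete v =>
    if v ∈ W then (P.guesses v).bind fun G =>
      (updateComponents (fun i => deleteLevels (P.test i) p v) G.toList D).bind
        fun D' => ret (p, W.erase v, D')
    else ret (p, W, D)

open Classical in
/-- The solution of a process with maximal value. -/
noncomputable def bestSolution (D : ι → List (S × Finset V)) : Finset V :=
  if h : ∃ i, ∀ j, P.value (finalState P.start (D j)) ≤ P.value (finalState P.start (D i)) then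
    P.solution (finalState P.start (D h.choose))
  else ∅

variable {P O} {Inv : ι → ℕ → S → Prop} {T c c₀ g s : ℕ}

theorem participants_insert_of_mem {W : Finset V} {v : V} {i : ι}
    (h : i ∈ (P.guesses v).eval O) :
    P.participants O (insert v W) i = insert v (P.participants O W i) := by
  rw [participants, Finset.filter_insert, if_pos h, participants]

theorem participants_insert_of_notMem {W : Finset V} {v : V} {i : ι}
    (h : i ∉ (P.guesses v).eval O) :
    P.participants O (insert v W) i = P.participants O W i := by
  rw [participants, Finset.filter_insert, if_neg h, participants]

theorem participants_erase (W : Finset V) (v : V) (i : ι) :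
    P.participants O (W.erase v) i = (P.participants O W i).erase v :=
  Finset.filter_erase _ _ _

/-- The cost of an update of the element `v`, where `U` consists of `v` and the other present
elements. -/
theorem process_spec (hP : P.IsEfficient O Inv T c c₀ g) (hs : T + 1 < 2 ^ s) (W : Finset V)
    (x : Update V) : ∃ (U : Finset V) (v : V), ∀ p : V ≃ Fin N,
      (P.process (P.memory O W p) x).eval O = P.memory O (x.apply W) p ∧
      (P.process (P.memory O W p) x).cost O ≤ c₀ + ∑ i ∈ (P.guesses v).eval O,
        c * (s + 1) * (1 + rebuildSize p v (P.structures O p U i)) := by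
  rcases x with v | v
  · refine ⟨insert v W, v, fun p => ?_⟩
    by_cases hv : v ∈ W
    · simp [memory, process, hv, Update.apply]
    · have key := fun i => insertLevels_buildLevels_spec (tst := P.test i) (p := p) (A :=
        P.participants O W i) (hP.isFilterProcess i) (hP.cost_test i)
        (fun h => hv (Finset.filter_subset _ _ h)) (hP.start i) hs
      simp only [memory, process, hv, if_false, eval_bind, cost_bind, eval_ret, cost_ret,
        Update.apply, (updateComponents_spec O _ _ (Finset.nodup_toList _) _).1,
        (updateComponents_spec O _ _ (Finset.nodup_toList _) _).2, Finset.mem_toList, add_zero]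
      constructor
      · congr 2
        funext i
        split_ifs with hi
        · rw [structures, structures, participants_insert_of_mem hi]
          exact (key i).1
        · rw [structures, structures, participants_insert_of_notMem hi]
      · refine add_le_add (hP.cost_guesses v) ?_
        rw [Finset.sum_map_toList]
        refine Finset.sum_le_sum fun i hi => ?_
        rw [structures, structures, participants_insert_of_mem hi]
        exact (key i).2
  · refine ⟨W, v, fun p => ?_⟩
    by_cases hv : v ∈ W
    · have key := fun i => deleteLevels_spec (tst := P.test i) (p := p) (v := v) (A :=
        P.participants O W i) (hP.isFilterProcess i) (hP.cost_test i) (hP.start i) hs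
      simp only [memory, process, hv, if_true, eval_bind, cost_bind, eval_ret, cost_ret,
        Update.apply, (updateComponents_spec O _ _ (Finset.nodup_toList _) _).1,
        (updateComponents_spec O _ _ (Finset.nodup_toList _) _).2, Finset.mem_toList, add_zero]
      constructor
      · congr 2
        funext i
        split_ifs with hi
        · rw [structures, structures, participants_erase]
          exact (key i).1
        · rw [structures, structures, participants_erase, Finset.erase_eq_of_notMem]
          exact fun h => hi (Finset.mem_filter.1 h).2
      · refine add_le_add (hP.cost_guesses v) ?_
        rw [Finset.sum_map_toList]
        refine Finset.sum_le_sum fun i hi => ((key i).2).trans ?_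
        exact Nat.mul_le_mul_left _ (Nat.le_add_left _ _)
    · simp [memory, process, hv, Update.apply]

theorem sum_cost_process_le [Fintype V] (hP : P.IsEfficient O Inv T c c₀ g) (hs : T + 1 < 2 ^ s)
    (W : Finset V) (x : Update V) :
    ∑ p : V ≃ Fin N, (P.process (P.memory O W p) x).cost O ≤
      Fintype.card (V ≃ Fin N) * (c₀ + g * (c * (s + 1) * (1 + T))) := by
  obtain ⟨U, v, h⟩ := process_spec (N := N) hP hs W x
  refine (Finset.sum_le_sum fun p _ => (h p).2).trans ?_
  rw [Finset.sum_add_distrib, Finset.sum_comm, mul_add (Fintype.card _)]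
  refine add_le_add (by simp) ?_
  calc ∑ i ∈ (P.guesses v).eval O, ∑ p : V ≃ Fin N,
        c * (s + 1) * (1 + rebuildSize p v (P.structures O p U i))
      ≤ ∑ i ∈ (P.guesses v).eval O,
          c * (s + 1) * (Fintype.card (V ≃ Fin N) * (1 + T)) := by
        refine Finset.sum_le_sum fun i _ => ?_
        rw [← Finset.mul_sum, Finset.sum_add_distrib, mul_add (Fintype.card _)]
        refine Nat.mul_le_mul_left _ (add_le_add (by simp) ?_)
        exact sum_rebuildSize_le (hP.isFilterProcess i) (hP.start i) _ v
    _ ≤ g * (c * (s + 1) * (Fintype.card (V ≃ Fin N) * (1 + T))) := by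
        rw [Finset.sum_const, smul_eq_mul]
        exact Nat.mul_le_mul_right _ (hP.card_guesses v)
    _ = _ := by ring

section Algorithm

variable {M : ℕ} (E : Fin (M + 1) ≃ (V ≃ Fin N))

variable (P) in
/-- The dynamic algorithm: at the first update, a uniformly random order of the ground set is drawn,
in the form of an index for the enumeration `E` of all orders. Afterwards, the level structures of
all processes for this order are maintained. -/
noncomputable def algorithm : DynamicAlgorithm V R where
  State := Option (Memory V S ι N)
  init := none
  update
    | none, x => .sample M fun i =>
        ((P.process (E i, ∅, fun _ => [(P.start, ∅)]) x).bind fun m => ret (some m)).toComp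
    | some m, x => ((P.process m x).bind fun m => ret (some m)).toComp
  output
    | none => ∅
    | some m => P.bestSolution m.2.2

theorem memory_empty (p : V ≃ Fin N) : P.memory O ∅ p = (p, ∅, fun _ => [(P.start, ∅)]) := by
  have : P.structures O p ∅ = fun _ => [(P.start, ∅)] :=
    funext fun i => levels_of_empty (by simp [participants, accepted])
  rw [memory, this]

variable (P) in
/-- The state of the dynamic algorithm with a given memory. -/
def toState (m : Memory V S ι N) : (P.algorithm E).State := some m

theorem update_init_run (x : Update V) :
    ((P.algorithm E).update (P.algorithm E).init x).run O =
      (PMF.uniformOfFintype (Fin (M + 1))).bind fun i =>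
        PMF.pure (P.toState E ((P.process (P.memory O ∅ (E i)) x).eval O),
          (P.process (P.memory O ∅ (E i)) x).cost O) := by
  simp only [toState]
  simp only [algorithm, OracleComp.run, run_toComp, eval_bind, cost_bind, eval_ret, cost_ret,
    memory_empty, add_zero]

theorem update_toState_run (m : Memory V S ι N) (x : Update V) :
    ((P.algorithm E).update (P.toState E m) x).run O =
      PMF.pure (P.toState E ((P.process m x).eval O), (P.process m x).cost O) := by
  simp only [toState]
  simp only [algorithm, run_toComp, eval_bind, cost_bind, eval_ret, cost_ret, add_zero]

omit [DecidableEq V] in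
theorem stateAfter_append (alg : DynamicAlgorithm V R) (X : List (Update V)) (x : Update V) :
    alg.stateAfter O (X ++ [x]) =
      (alg.stateAfter O X).bind fun s => ((alg.update s x).run O).map Prod.fst := by
  simp [DynamicAlgorithm.stateAfter]

/-- The state is a function of the random order and of the present elements. -/
theorem stateAfter_eq (hP : P.IsEfficient O Inv T c c₀ g) (X : List (Update V)) (hX : X ≠ []) :
    (P.algorithm E).stateAfter O X = (PMF.uniformOfFintype (Fin (M + 1))).map
      fun i => P.toState E (P.memory O (liveSet X) (E i)) := by
  induction X using List.reverseRecOn with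
  | nil => exact absurd rfl hX
  | append_singleton X x ih =>
    have hlive : liveSet (X ++ [x]) = x.apply (liveSet X) := by simp [liveSet]
    have hproc : ∀ i, (P.process (P.memory O (liveSet X) (E i)) x).eval O =
        P.memory O (liveSet (X ++ [x])) (E i) := by
      obtain ⟨U, v, h⟩ := process_spec (N := N) hP (Nat.lt_two_pow_self) (liveSet X) x
      intro i
      rw [hlive]
      exact (h (E i)).1
    rw [stateAfter_append]
    rcases eq_or_ne X [] with rfl | hne
    · have : (P.algorithm E).stateAfter O [] = PMF.pure (P.algorithm E).init := rfl
      rw [this, PMF.pure_bind, update_init_run, PMF.map_bind]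
      simp only [PMF.pure_map]
      simp only [liveSet, List.foldl_nil] at hproc
      simp only [hproc]
      rfl
    · rw [ih hne, PMF.bind_map]
      have : ((fun s => PMF.map Prod.fst (((P.algorithm E).update s x).run O)) ∘
          fun i => P.toState E (P.memory O (liveSet X) (E i))) =
          fun i => PMF.pure (P.toState E (P.memory O (liveSet (X ++ [x])) (E i))) := by
        funext i
        rw [Function.comp_apply, update_toState_run, PMF.pure_map, hproc]
      rw [this]
      rfl

theorem tsum_bind_mul {α β : Type*} (μ : PMF α) (κ : α → PMF β) (F : β → ℝ≥0∞) :
    ∑' b, μ.bind κ b * F b = ∑' a, μ a * ∑' b, κ a b * F b := by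
  simp only [PMF.bind_apply, ← ENNReal.tsum_mul_right, ← ENNReal.tsum_mul_left]
  rw [ENNReal.tsum_comm]
  simp only [mul_assoc]

theorem tsum_pure_mul {α : Type*} (a : α) (F : α → ℝ≥0∞) : ∑' b, PMF.pure a b * F b = F a := by
  rw [tsum_eq_single a fun b hb => by simp [PMF.pure_apply, hb]]
  simp

theorem expectedQueries_eq (hP : P.IsEfficient O Inv T c c₀ g) (X : List (Update V))
    (x : Update V) :
    (P.algorithm E).expectedQueries O X x =
      ∑ i : Fin (M + 1), ((M + 1 : ℕ) : ℝ≥0∞)⁻¹ *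
        ((P.process (P.memory O (liveSet X) (E i)) x).cost O : ℝ≥0∞) := by
  have huni : ∀ F : Fin (M + 1) → ℝ≥0∞,
      ∑' i, PMF.uniformOfFintype (Fin (M + 1)) i * F i =
        ∑ i, ((M + 1 : ℕ) : ℝ≥0∞)⁻¹ * F i := by
    intro F
    simp [tsum_fintype]
  rw [DynamicAlgorithm.expectedQueries]
  rcases eq_or_ne X [] with rfl | hne
  · have : (P.algorithm E).stateAfter O [] = PMF.pure (P.algorithm E).init := rfl
    rw [this, tsum_pure_mul, update_init_run, tsum_bind_mul]
    simp only [tsum_pure_mul]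
    exact huni _
  · rw [stateAfter_eq E hP X hne, PMF.map, tsum_bind_mul]
    simp only [Function.comp_apply, tsum_pure_mul, update_toState_run]
    exact huni _

theorem queryComplexityLE [Fintype V] (hP : P.IsEfficient O Inv T c c₀ g) (hs : T + 1 < 2 ^ s)
    {b : ℝ} (hb : (c₀ + g * (c * (s + 1) * (1 + T)) : ℝ) ≤ b) (X : List (Update V)) :
    (P.algorithm E).QueryComplexityLE O X b := by
  intro t ht
  rw [expectedQueries_eq E hP, ← Finset.mul_sum,
    Equiv.sum_comp E fun p =>
      ((P.process (P.memory O (liveSet (X.take t)) p) X[t]).cost O : ℝ≥0∞), ← Nat.cast_sum]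
  have hcard : Fintype.card (V ≃ Fin N) = M + 1 := by
    rw [← Fintype.card_congr E, Fintype.card_fin]
  have h1 := sum_cost_process_le (N := N) hP hs (liveSet (X.take t)) X[t]
  rw [hcard] at h1
  calc _ ≤ ((M + 1 : ℕ) : ℝ≥0∞)⁻¹ *
        (((M + 1) * (c₀ + g * (c * (s + 1) * (1 + T))) : ℕ) : ℝ≥0∞) := by
        gcongr
    _ = ((c₀ + g * (c * (s + 1) * (1 + T)) : ℕ) : ℝ≥0∞) := by
        rw [Nat.cast_mul, ← mul_assoc, ENNReal.inv_mul_cancel, one_mul]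
        · simp
        · exact ENNReal.natCast_ne_top _
    _ ≤ ENNReal.ofReal b := by
        rw [← ENNReal.ofReal_natCast]
        refine ENNReal.ofReal_le_ofReal ?_
        push_cast
        exact hb

theorem maintains (hP : P.IsEfficient O Inv T c c₀ g) {f : Finset V → ℝ}
    {feasible : Finset V → Prop} {a : ℝ} (h0 : IsApproxSolution f feasible ∅ a ∅)
    (h : ∀ (p : V ≃ Fin N) (W : Finset V),
      IsApproxSolution f feasible W a (P.bestSolution (P.structures O p W)))
    (X : List (Update V)) : (P.algorithm E).Maintains O f feasible a X := by
  intro t _ s hs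
  rcases eq_or_ne (X.take t) [] with hX | hX
  · rw [hX] at hs ⊢
    have : (P.algorithm E).stateAfter O [] = PMF.pure (P.algorithm E).init := rfl
    rw [this, PMF.support_pure, Set.mem_singleton_iff] at hs
    subst hs
    exact h0
  · rw [stateAfter_eq E hP _ hX, PMF.support_map] at hs
    obtain ⟨i, -, rfl⟩ := hs
    exact h _ _

end Algorithm

/-- Some process attains the maximal value, as only finitely many have participants at all. -/
theorem exists_best [Fintype V] (p : V ≃ Fin N) (W : Finset V) [Nonempty ι] :
    ∃ i, ∀ j, P.value (finalState P.start (P.structures O p W j)) ≤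
      P.value (finalState P.start (P.structures O p W i)) := by
  set F : ι → ℝ := fun j => P.value (finalState P.start (P.structures O p W j)) with hF
  have hfin : (Set.range F).Finite := by
    refine ((Set.toFinite {P.value P.start}).union ((W.biUnion fun v =>
      (P.guesses v).eval O).finite_toSet.image F)).subset ?_
    rintro _ ⟨j, rfl⟩
    by_cases hj : j ∈ W.biUnion fun v => (P.guesses v).eval O
    · exact Or.inr ⟨j, hj, rfl⟩
    · left
      have : P.participants O W j = ∅ := by
        refine Finset.filter_eq_empty_iff.2 fun v hv hjv => hj ?_
        exact Finset.mem_biUnion.2 ⟨v, hv, hjv⟩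
      simp only [hF, Set.mem_singleton_iff, structures, this]
      rw [finalState_levels_of_empty (by simp [accepted])]
  obtain ⟨_, ⟨i, rfl⟩, hi⟩ := (Set.range F).exists_max_image id hfin (Set.range_nonempty F)
  exact ⟨i, fun j => hi _ ⟨j, rfl⟩⟩

/-- A solution with maximal value is approximately optimal if every process maintains a feasible
solution and some process has a state of sufficiently large value. -/
theorem isApproxSolution_bestSolution [Fintype V] [Nonempty ι] {f : Finset V → ℝ}
    {feasible : Finset V → Prop} {a : ℝ} (ha : 0 ≤ a) (p : V ≃ Fin N) (W : Finset V)
    (hsub : ∀ i, P.solution (finalState P.start (P.structures O p W i)) ⊆ W ∧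
      feasible (P.solution (finalState P.start (P.structures O p W i))) ∧
      P.value (finalState P.start (P.structures O p W i)) ≤
        f (P.solution (finalState P.start (P.structures O p W i))))
    (hopt : ∀ J ⊆ W, feasible J →
      ∃ i, f J ≤ a * P.value (finalState P.start (P.structures O p W i))) :
    IsApproxSolution f feasible W a (P.bestSolution (P.structures O p W)) := by
  have h := exists_best (P := P) (O := O) p W
  rw [bestSolution, dif_pos h]
  refine ⟨(hsub _).1, (hsub _).2.1, fun J hJ hfeas => ?_⟩
  obtain ⟨i, hi⟩ := hopt J hJ hfeas
  exact hi.trans (mul_le_mul_of_nonneg_left ((h.choose_spec i).trans (hsub _).2.2) ha)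

end GuessedProcess

/-! ### Monotone submodular functions -/

namespace IsMonotoneSubmodular

variable {V : Type u} [DecidableEq V] {f : Finset V → ℝ}

theorem nonneg (hf : IsMonotoneSubmodular f) (A : Finset V) : 0 ≤ f A :=
  hf.map_empty ▸ hf.mono ∅ A (Finset.empty_subset A)

theorem gain_nonneg (hf : IsMonotoneSubmodular f) (A : Finset V) (e : V) :
    0 ≤ f (insert e A) - f A :=
  sub_nonneg.2 (hf.mono _ _ (Finset.subset_insert e A))

theorem gain_anti (hf : IsMonotoneSubmodular f) {A B : Finset V} (h : A ⊆ B) (e : V) :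
    f (insert e B) - f B ≤ f (insert e A) - f A := by
  by_cases he : e ∈ B
  · rw [Finset.insert_eq_of_mem he, sub_self]
    exact hf.gain_nonneg A e
  · exact hf.submodular A B h e he

theorem gain_le_singleton (hf : IsMonotoneSubmodular f) (A : Finset V) (e : V) :
    f (insert e A) - f A ≤ f {e} := by
  simpa [hf.map_empty] using hf.gain_anti (Finset.empty_subset A) e

theorem le_add_sum_gain (hf : IsMonotoneSubmodular f) (A J : Finset V) :
    f J ≤ f A + ∑ e ∈ J \ A, (f (insert e A) - f A) := by
  have key : ∀ K : Finset V, f (A ∪ K) ≤ f A + ∑ e ∈ K, (f (insert e A) - f A) := by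
    intro K
    induction K using Finset.induction_on with
    | empty => simp
    | insert e K he ih =>
      rw [Finset.union_insert, Finset.sum_insert he]
      have := hf.gain_anti (Finset.subset_union_left (s₁ := A) (s₂ := K)) e
      linarith
  refine (hf.mono _ _ ?_).trans (key (J \ A))
  rw [Finset.union_sdiff_self_eq_union]
  exact Finset.subset_union_right

end IsMonotoneSubmodular

/-! ### Guessing the optimal value -/

open Classical in
/-- The exponents `i` for which the power `b ^ i` is between `a` and `K * a`. -/
noncomputable def guessWindow (b K a : ℝ) : Finset ℤ :=
  if 0 < a then Finset.Icc ⌈Real.logb b a⌉ ⌊Real.logb b (K * a)⌋ else ∅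

theorem mem_guessWindow {b K a : ℝ} (hb : 1 < b) (hK : 0 < K) (ha : 0 < a) {i : ℤ} :
    i ∈ guessWindow b K a ↔ a ≤ b ^ i ∧ b ^ i ≤ K * a := by
  rw [guessWindow, if_pos ha, Finset.mem_Icc, Int.ceil_le, Int.le_floor,
    Real.logb_le_iff_le_rpow hb ha, Real.le_logb_iff_rpow_le hb (mul_pos hK ha),
    Real.rpow_intCast]

theorem card_guessWindow_le {b K : ℝ} (hb : 1 < b) (hK : 1 ≤ K) (a : ℝ) :
    (guessWindow b K a).card ≤ ⌊Real.logb b K + 1⌋₊ := by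
  rw [guessWindow]
  split_ifs with ha
  · have hlog : 0 ≤ Real.logb b K := Real.logb_nonneg hb hK
    rw [Int.card_Icc, Real.logb_mul (by positivity) ha.ne', Nat.le_floor_iff (by positivity)]
    have h1 := Int.floor_le (Real.logb b K + Real.logb b a)
    have h2 := Int.le_ceil (Real.logb b a)
    rcases le_total 0 (⌊Real.logb b K + Real.logb b a⌋ + 1 - ⌈Real.logb b a⌉) with h | h
    · have h3 : ((⌊Real.logb b K + Real.logb b a⌋ + 1 - ⌈Real.logb b a⌉).toNat : ℝ) =
          ((⌊Real.logb b K + Real.logb b a⌋ + 1 - ⌈Real.logb b a⌉ : ℤ) : ℝ) := by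
        exact_mod_cast congrArg (fun z : ℤ => (z : ℝ)) (Int.toNat_of_nonneg h)
      rw [h3]
      push_cast
      linarith
    · rw [Int.toNat_of_nonpos h]
      push_cast
      linarith
  · simp

/-! ### Constraints of rank zero -/

/-- The dynamic algorithm that always returns the empty set. -/
def trivialAlgorithm (V : Type u) {Q : Type u} (R : Q → Type) : DynamicAlgorithm V R where
  State := PUnit
  init := ⟨⟩
  update _ _ := .ret ⟨⟩
  output _ := ∅

theorem trivialAlgorithm_maintains {V : Type u} [DecidableEq V] {Q : Type u} {R : Q → Type}
    (O : ∀ q, R q) {f : Finset V → ℝ} {feasible : Finset V → Prop} (a : ℝ) (hf : f ∅ = 0)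
    (h0 : feasible ∅) (h : ∀ J, feasible J → J = ∅) (X : List (Update V)) :
    (trivialAlgorithm V R).Maintains O f feasible a X :=
  fun t _ _ _ => ⟨Finset.empty_subset _, h0, fun J _ hJ => by simp [h J hJ, trivialAlgorithm, hf]⟩

theorem trivialAlgorithm_queryComplexityLE {V : Type u} {Q : Type u} {R : Q → Type}
    (O : ∀ q, R q) (b : ℝ) (X : List (Update V)) :
    (trivialAlgorithm V R).QueryComplexityLE O X b := by
  intro t ht
  have h : ∀ s x, ∑' y : (trivialAlgorithm V R).State × ℕ,
      ((trivialAlgorithm V R).update s x).run O y * (y.2 : ℝ≥0∞) = 0 := by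
    intro s x
    exact (GuessedProcess.tsum_pure_mul _ _).trans Nat.cast_zero
  simp [DynamicAlgorithm.expectedQueries, h]

/-! ### Cardinality constraint -/

namespace CardinalityConstraint

open DecisionTree

variable {V : Type u} [DecidableEq V]

/-- A state consists of the current solution and its value. -/
abbrev State (V : Type u) : Type u := Finset V × ℝ

/-- An element is added to the current solution if it gains at least `θ` and there is room for
it. -/
noncomputable def test (k : ℕ) (θ : ℝ) (σ : State V) (v : V) :
    DecisionTree (ValueAnswer V) (Option (State V)) :=
  if k ≤ σ.1.card then ret none
  else ask (R := ValueAnswer V) (insert v σ.1) fun (a : ℝ) => open Classical in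
    ret (if θ ≤ a - σ.2 then some (insert v σ.1, a) else none)

/-- The thresholding process for the guess `b ^ i`, which is intended to exceed the optimal value by
a factor of at most `b`: the threshold is half the `k`-th part of `b ^ (i - 1)`. -/
noncomputable def process (V : Type u) [DecidableEq V] (k : ℕ) (b : ℝ) :
    GuessedProcess (ValueAnswer V) V (State V) ℤ where
  test i := test k (b ^ i / (2 * k * b))
  guesses v := ask (R := ValueAnswer V) {v} fun (a : ℝ) => ret (guessWindow b (2 * k * b) a)
  start := (∅, 0)
  solution := Prod.fst
  value := Prod.snd

/-- The states from which `n` further elements can be added. -/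
def Inv (f : Finset V → ℝ) (k n : ℕ) (σ : State V) : Prop :=
  σ.2 = f σ.1 ∧ σ.1.card + n = k

theorem test_eq_some {k : ℕ} {θ : ℝ} {f : Finset V → ℝ} {σ σ' : State V} {v : V} :
    (test k θ σ v).eval f = some σ' ↔
      σ.1.card < k ∧ θ ≤ f (insert v σ.1) - σ.2 ∧ σ' = (insert v σ.1, f (insert v σ.1)) := by
  rw [test]
  split_ifs with h
  · simp [h]
  · simp only [eval_ask, eval_ret, not_le.1 h, true_and]
    split_ifs with h' <;> simp [h', eq_comm]

theorem test_eq_none {k : ℕ} {θ : ℝ} {f : Finset V → ℝ} {σ : State V} {v : V} :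
    (test k θ σ v).eval f = none ↔ k ≤ σ.1.card ∨ f (insert v σ.1) - σ.2 < θ := by
  rw [test]
  split_ifs with h
  · simp [h]
  · simp [h]

theorem isFilterProcess {f : Finset V → ℝ} (hf : IsMonotoneSubmodular f) (k : ℕ) {θ : ℝ}
    (hθ : 0 < θ) : IsFilterProcess (fun σ v => (test k θ σ v).eval f) (Inv f k) where
  next := by
    rintro n σ v σ' ⟨h1, h2⟩ hs
    obtain ⟨hk, hgain, rfl⟩ := test_eq_some.1 hs
    have hv : v ∉ σ.1 := fun hv => by
      rw [Finset.insert_eq_of_mem hv, h1, sub_self] at hgain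
      linarith
    refine ⟨n - 1, by omega, rfl, ?_⟩
    rw [Finset.card_insert_of_notMem hv]
    omega
  reject_of_reject := by
    rintro n σ v w σ' ⟨h1, h2⟩ hs hv
    obtain ⟨hk, hgain, rfl⟩ := test_eq_some.1 hs
    rw [test_eq_none] at hv ⊢
    right
    have := hf.gain_anti (Finset.subset_insert w σ.1) v
    rw [h1] at hv
    exact this.trans_lt (hv.resolve_left (by omega))
  reject_of_accept := by
    rintro n σ v σ' ⟨h1, h2⟩ hs
    obtain ⟨hk, hgain, rfl⟩ := test_eq_some.1 hs
    rw [test_eq_none]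
    right
    simpa using hθ

theorem isEfficient {f : Finset V → ℝ} (hf : IsMonotoneSubmodular f) {k : ℕ} (hk : 1 ≤ k) {b : ℝ}
    (hb : 1 < b) :
    (process V k b).IsEfficient f (fun _ => Inv f k) k 1 1 ⌊Real.logb b (2 * k * b) + 1⌋₊ where
  isFilterProcess i := by
    have : (0 : ℝ) < k := by exact_mod_cast hk
    exact isFilterProcess hf k (by positivity)
  start i := ⟨hf.map_empty.symm, by simp [process]⟩
  cost_test i n σ v _ := by
    simp only [process, test]
    split_ifs <;> simp
  cost_guesses v := by simp [process]
  card_guesses v := by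
    have : (1 : ℝ) ≤ k := by exact_mod_cast hk
    exact card_guessWindow_le hb (by nlinarith) _

theorem isApproxSolution [Finite V] {f : Finset V → ℝ} (hf : IsMonotoneSubmodular f) {k : ℕ}
    (hk : 1 ≤ k) {b : ℝ} (hb : 1 < b) {N : ℕ} (p : V ≃ Fin N) (W : Finset V) :
    IsApproxSolution f (fun I => I.card ≤ k) W (2 * b)
      ((process V k b).bestSolution ((process V k b).structures f p W)) := by
  have := Fintype.ofFinite V
  have hk' : (0 : ℝ) < k := by exact_mod_cast hk
  set P := process V k b with hP
  have hE := isEfficient hf hk hb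
  have hfin : ∀ i, (fun σ : State V => σ.2 = f σ.1 ∧ σ.1 ⊆ W ∧ σ.1.card ≤ k ∧
      b ^ i / (2 * k * b) * σ.1.card ≤ σ.2)
      (finalState P.start (P.structures f p W i)) := by
    intro i
    refine finalState_levels_induction (J := fun σ : State V => σ.2 = f σ.1 ∧ σ.1 ⊆ W ∧
      σ.1.card ≤ k ∧ b ^ i / (2 * k * b) * σ.1.card ≤ σ.2)
      ⟨hf.map_empty.symm, by simp [hP, process]⟩ ?_
    rintro σ v σ' hv ⟨h1, h2, h3, h4⟩ hs
    obtain ⟨hcard, hgain, rfl⟩ := test_eq_some.1 hs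
    refine ⟨rfl, Finset.insert_subset (Finset.filter_subset _ _ hv) h2,
      (Finset.card_insert_le _ _).trans hcard, ?_⟩
    have h5 : ((insert v σ.1).card : ℝ) ≤ σ.1.card + 1 := by
      exact_mod_cast Finset.card_insert_le v σ.1
    have h6 := mul_le_mul_of_nonneg_left h5 (by positivity : 0 ≤ b ^ i / (2 * k * b))
    have hgain : b ^ i / (2 * k * b) ≤ f (insert v σ.1) - σ.2 := hgain
    simp only
    linarith
  refine GuessedProcess.isApproxSolution_bestSolution (by linarith) p W
    (fun i => ⟨(hfin i).2.1, (hfin i).2.2.1, (hfin i).1.le⟩) ?_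
  intro J hJ hJk
  obtain ⟨J₀, hJ₀, hmax⟩ := (W.powerset.filter fun J => J.card ≤ k).exists_max_image f
    ⟨∅, by simp⟩
  simp only [Finset.mem_filter, Finset.mem_powerset] at hJ₀ hmax
  have hJJ₀ := hmax J ⟨hJ, hJk⟩
  rcases (hf.nonneg J₀).eq_or_lt with h0 | hpos
  · refine ⟨0, ?_⟩
    rw [← h0] at hJJ₀
    refine hJJ₀.trans (mul_nonneg (by linarith) ?_)
    exact (hf.nonneg _).trans (hfin 0).1.ge
  obtain ⟨n, hn⟩ := exists_mem_Ico_zpow hpos hb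
  refine ⟨n + 1, ?_⟩
  set σ := finalState P.start (P.structures f p W (n + 1)) with hσ
  obtain ⟨h1, h2, h3, h4⟩ := hfin (n + 1)
  change f J ≤ 2 * b * σ.2
  rw [← hσ] at h1 h2 h3 h4
  have hbn : b ^ (n + 1) = b ^ n * b := zpow_add_one₀ (by linarith) n
  have hθ : b ^ (n + 1) / (2 * k * b) = b ^ n / (2 * k) := by
    rw [hbn]
    field_simp
  rw [hθ] at h4
  by_cases hfull : k ≤ σ.1.card
  · have hcard : (σ.1.card : ℝ) = k := by exact_mod_cast le_antisymm h3 hfull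
    rw [hcard] at h4
    have h5 : b ^ n / (2 * k) * k = b ^ n / 2 := by field_simp
    have h6 : b ^ n / 2 ≤ σ.2 := h5 ▸ h4
    have h7 : b ^ (n + 1) ≤ 2 * b * σ.2 := by
      rw [hbn]
      nlinarith
    linarith [hn.2]
  · have hgain : ∀ v ∈ J₀ \ σ.1, f (insert v σ.1) - f σ.1 ≤ b ^ n / (2 * k) := by
      intro v hv
      have hvW : v ∈ W := hJ₀.1 (Finset.mem_sdiff.1 hv).1
      have hsing := hf.gain_le_singleton σ.1 v
      by_cases hpart : n + 1 ∈ guessWindow b (2 * k * b) (f {v})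
      · have hrej := reject_finalState (p := p) (σ₀ := P.start)
          (hE.isFilterProcess (n + 1)) (hE.start (n + 1)) (v := v)
          (A := P.participants f W (n + 1)) (Or.inl (Finset.mem_filter.2 ⟨hvW, hpart⟩))
        have := (test_eq_none.1 hrej).resolve_left hfull
        rw [← h1, ← hθ]
        exact this.le
      · rcases (hf.nonneg {v}).eq_or_lt with hv0 | hv0
        · rw [← hv0] at hsing
          exact hsing.trans (by positivity)
        · rw [mem_guessWindow hb (by positivity) hv0, not_and, not_le] at hpart
          have h5 := hpart ((hmax {v} ⟨by simpa using hvW, by simpa using hk⟩).trans hn.2.le)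
          refine hsing.trans ?_
          rw [← hθ, le_div_iff₀ (by positivity)]
          linarith
    have hsum := Finset.sum_le_card_nsmul _ _ _ hgain
    have hcard : ((J₀ \ σ.1).card : ℝ) ≤ k := by
      exact_mod_cast (Finset.card_le_card Finset.sdiff_subset).trans hJ₀.2
    rw [nsmul_eq_mul] at hsum
    have h5 : ((J₀ \ σ.1).card : ℝ) * (b ^ n / (2 * k)) ≤ k * (b ^ n / (2 * k)) :=
      mul_le_mul_of_nonneg_right hcard (by positivity)
    have h6 : (k : ℝ) * (b ^ n / (2 * k)) = b ^ n / 2 := by field_simp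
    have h7 := hf.le_add_sum_gain σ.1 J₀
    have h8 : f J₀ ≤ 2 * σ.2 := by rw [h1]; linarith [hn.1]
    have h9 : 0 ≤ σ.2 := by rw [h1]; exact hf.nonneg _
    nlinarith

theorem complexity_bound {k : ℕ} (hk : 1 ≤ k) {ε : ℝ} (hε : 0 < ε) (hε1 : ε ≤ 1) :
    ((1 : ℕ) + ⌊Real.logb (1 + ε / 2) (2 * k * (1 + ε / 2)) + 1⌋₊ *
      ((1 : ℕ) * ((Nat.log 2 (k + 1) + 1 : ℕ) + 1) * (1 + k)) : ℝ) ≤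
        172 * (k * ε⁻¹ * Real.log (k + 1) ^ 2) := by
  have hk' : (1 : ℝ) ≤ k := by exact_mod_cast hk
  have hlog2 := Real.log_two_gt_d9
  set L := Real.log (k + 1) with hL
  have hL2 : Real.log 2 ≤ L := Real.log_le_log (by norm_num) (by linarith)
  have hL0 : 0 < L := by linarith
  have hε' : 1 ≤ ε⁻¹ := (one_le_inv₀ hε).2 hε1
  have hs : ((Nat.log 2 (k + 1) + 1 : ℕ) + 1 : ℝ) ≤ 6 * L := by
    have h1 : ((Nat.log 2 (k + 1) : ℕ) : ℝ) ≤ Real.logb 2 ((k + 1 : ℕ) : ℝ) :=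
      Real.natLog_le_logb _ _
    rw [Real.logb, le_div_iff₀ (by linarith)] at h1
    push_cast at h1 ⊢
    rw [← hL] at h1
    have h2 : (0 : ℝ) ≤ Nat.log 2 (k + 1) := by positivity
    nlinarith
  have hlogb : ε / 4 ≤ Real.log (1 + ε / 2) := by
    refine le_trans ?_ (Real.le_log_one_add_of_nonneg (by linarith : (0 : ℝ) ≤ ε / 2))
    rw [le_div_iff₀ (by linarith)]
    nlinarith
  have hg : (⌊Real.logb (1 + ε / 2) (2 * k * (1 + ε / 2)) + 1⌋₊ : ℝ) ≤ 14 * L * ε⁻¹ := by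
    have h1 : Real.log (2 * k * (1 + ε / 2)) ≤ 3 * L := by
      have h2 : Real.log (2 * k * (1 + ε / 2)) ≤ Real.log (2 * 2 * (k + 1)) :=
        Real.log_le_log (by positivity) (by nlinarith)
      have h3 : Real.log (2 * 2 * (k + 1)) = Real.log 2 + Real.log 2 + L := by
        rw [Real.log_mul (by norm_num) (by linarith), Real.log_mul (by norm_num) (by norm_num)]
      rw [h3] at h2
      linarith
    have h3 : Real.logb (1 + ε / 2) (2 * k * (1 + ε / 2)) ≤ 12 * L * ε⁻¹ := by
      rw [Real.logb, div_le_iff₀ (by linarith)]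
      have h4 : 12 * L * ε⁻¹ * (ε / 4) = 3 * L := by field_simp; ring
      have h5 := mul_le_mul_of_nonneg_left hlogb (by positivity : 0 ≤ 12 * L * ε⁻¹)
      linarith
    have h6 : 0 ≤ Real.logb (1 + ε / 2) (2 * k * (1 + ε / 2)) :=
      Real.logb_nonneg (by linarith) (by nlinarith)
    refine (Nat.floor_le (by linarith)).trans ?_
    nlinarith
  have h1 : (⌊Real.logb (1 + ε / 2) (2 * k * (1 + ε / 2)) + 1⌋₊ : ℝ) *
      ((1 : ℕ) * ((Nat.log 2 (k + 1) + 1 : ℕ) + 1) * (1 + k)) ≤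
      14 * L * ε⁻¹ * (6 * L * (2 * k)) := by
    refine mul_le_mul hg (mul_le_mul ?_ ?_ ?_ ?_) ?_ ?_
    · simpa using hs
    · linarith
    all_goals positivity
  have h2 : 1 ≤ 4 * (k * ε⁻¹ * L ^ 2) := by
    have h3 : 1 ≤ (2 * L) ^ 2 := one_le_pow₀ (by linarith)
    have h4 : 1 ≤ k * ε⁻¹ := one_le_mul_of_one_le_of_one_le hk' hε'
    nlinarith
  push_cast at h1 ⊢
  linarith

end CardinalityConstraint

/-- The orders of a finite ground set can be enumerated, so that a uniformly random one can be drawn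
by a `sample`. -/
theorem exists_enumeration (V : Type u) [Finite V] :
    ∃ N M : ℕ, Nonempty (Fin (M + 1) ≃ (V ≃ Fin N)) := by
  classical
  have := Fintype.ofFinite V
  have hpos : 0 < Fintype.card (V ≃ Fin (Fintype.card V)) :=
    Fintype.card_pos_iff.2 ⟨Fintype.equivFin V⟩
  refine ⟨Fintype.card V, Fintype.card (V ≃ Fin (Fintype.card V)) - 1, ⟨?_⟩⟩
  exact (Fintype.equivFinOfCardEq (by omega)).symm

theorem exists_cardinality_algorithm (V : Type u) [Finite V] [DecidableEq V] (k : ℕ) {ε : ℝ}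
    (hε : 0 < ε) (hε1 : ε ≤ 1) :
    ∃ alg : DynamicAlgorithm V (ValueAnswer V),
      ∀ f : Finset V → ℝ, IsMonotoneSubmodular f → ∀ S : List (Update V),
        alg.Maintains f f (fun I => I.card ≤ k) (2 + ε) S ∧
        alg.QueryComplexityLE f S (172 * (k * ε⁻¹ * Real.log (k + 1) ^ 2)) := by
  rcases Nat.eq_zero_or_pos k with rfl | hk
  · exact ⟨trivialAlgorithm V _, fun f hf S =>
      ⟨trivialAlgorithm_maintains f _ hf.map_empty (by simp) (by simp) S,
        trivialAlgorithm_queryComplexityLE f _ S⟩⟩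
  have := Fintype.ofFinite V
  obtain ⟨N, M, ⟨E⟩⟩ := exists_enumeration V
  have hb : 1 < 1 + ε / 2 := by linarith
  refine ⟨(CardinalityConstraint.process V k (1 + ε / 2)).algorithm E, fun f hf S => ⟨?_, ?_⟩⟩
  · have hfac : 2 + ε = 2 * (1 + ε / 2) := by ring
    rw [hfac]
    refine GuessedProcess.maintains E (CardinalityConstraint.isEfficient hf hk hb) ?_
      (fun p W => CardinalityConstraint.isApproxSolution hf hk hb p W) S
    refine ⟨subset_rfl, by simp, fun J hJ _ => ?_⟩
    rw [Finset.subset_empty.1 hJ, hf.map_empty, mul_zero]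
  · exact GuessedProcess.queryComplexityLE E (CardinalityConstraint.isEfficient hf hk hb)
      (Nat.lt_pow_succ_log_self one_lt_two _)
      (CardinalityConstraint.complexity_bound hk hε hε1) S

/-! ### Matroid constraint: the exchange process -/

namespace MatroidConstraint

open DecisionTree

variable {V : Type u} [DecidableEq V]

/-- A state consists of the current solution, the weights of its elements, the set of all elements
accepted so far, and the value of this set. -/
structure State (V : Type u) : Type u where
  sol : Finset V
  weight : V → ℝ
  seen : Finset V
  val : ℝ

open Classical in
/-- The elements of `I` in the order of nonincreasing weights. -/
noncomputable def byWeight (I : Finset V) (w : V → ℝ) : List V :=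
  I.toList.mergeSort fun x y => decide (w y ≤ w x)

/-- The state after `v` has been accepted, where `K` is what is kept from the solution and `a` is
the new value of the set of accepted elements. The weight of `v` is its gain over this set, not over
the solution. -/
def State.accept (σ : State V) (v : V) (a : ℝ) (K : Finset V) : State V where
  sol := insert v K
  weight := Function.update σ.weight v (a - σ.val)
  seen := insert v σ.seen
  val := a

/-- An element of value at most `τ` that gains at least `θ` over the set of all accepted elements is
added to the solution if this preserves independence; otherwise it replaces the lightest element of
the circuit that it closes, provided that its gain is at least twice the weight of this element. If
the solution is sorted by nonincreasing weight, then the lightest element of the circuit is the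
last one of the shortest prefix on which `v` depends. -/
noncomputable def test (τ θ : ℝ) (σ : State V) (v : V) :
    DecisionTree (MatroidAnswer V) (Option (State V)) :=
  ask (R := MatroidAnswer V) (.value {v}) fun (a₀ : ℝ) =>
  ask (R := MatroidAnswer V) (.value (insert v σ.seen)) fun (a : ℝ) => open Classical in
  if τ < a₀ ∨ a - σ.val < θ then ret none else
  (binarySearch (fun i => ask (R := MatroidAnswer V)
      (.indep (insert v ((byWeight σ.sol σ.weight).take i).toFinset)) fun (b : Bool) => ret b)
    0 ((byWeight σ.sol σ.weight).length + 1)).bind fun j =>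
  match j with
  | 0 => ret none
  | j + 1 =>
    match (byWeight σ.sol σ.weight)[j]? with
    | none => ret (some (σ.accept v a σ.sol))
    | some x =>
      if 2 * σ.weight x ≤ a - σ.val then ret (some (σ.accept v a (σ.sol.erase x))) else ret none

/-- The state rejects `v`: in the third case, `v` depends on elements of the solution that are too
heavy to be replaced by `v`. -/
def Rejects (f : Finset V → ℝ) (M : Matroid V) (τ θ : ℝ) (σ : State V) (v : V) : Prop :=
  τ < f {v} ∨ f (insert v σ.seen) - σ.val < θ ∨
    v ∈ M.closure {y | y ∈ σ.sol ∧ f (insert v σ.seen) - σ.val < 2 * σ.weight y}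

/-- `K` is kept from the solution when `v` is accepted: either `v` is independent of the whole
solution, or `v` replaces `x`, where `X` consists of elements that are at least as heavy. -/
def Keeps (f : Finset V → ℝ) (M : Matroid V) (σ : State V) (v : V) (K : Finset V) : Prop :=
  (K = σ.sol ∧ v ∉ M.closure σ.sol) ∨
    ∃ x ∈ σ.sol, ∃ X : Finset V, X ⊆ σ.sol ∧ x ∉ X ∧ (∀ y ∈ X, σ.weight x ≤ σ.weight y) ∧
      v ∉ M.closure X ∧ v ∈ M.closure (insert x (X : Set V)) ∧
      2 * σ.weight x ≤ f (insert v σ.seen) - σ.val ∧ K = σ.sol.erase x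

omit [DecidableEq V] in
theorem mem_byWeight {I : Finset V} {w : V → ℝ} {x : V} : x ∈ byWeight I w ↔ x ∈ I := by
  rw [byWeight, (List.mergeSort_perm _ _).mem_iff, Finset.mem_toList]

omit [DecidableEq V] in
theorem length_byWeight (I : Finset V) (w : V → ℝ) : (byWeight I w).length = I.card := by
  rw [byWeight, List.length_mergeSort, Finset.length_toList]

omit [DecidableEq V] in
theorem nodup_byWeight (I : Finset V) (w : V → ℝ) : (byWeight I w).Nodup :=
  (List.mergeSort_perm _ _).nodup_iff.2 I.nodup_toList

omit [DecidableEq V] in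
theorem pairwise_byWeight (I : Finset V) (w : V → ℝ) :
    (byWeight I w).Pairwise fun x y => w y ≤ w x := by
  classical
  have h := List.pairwise_mergeSort (le := fun x y : V => decide (w y ≤ w x))
    (by simp only [decide_eq_true_eq]; intro a b c h1 h2; exact h2.trans h1)
    (by simp only [Bool.or_eq_true, decide_eq_true_eq]; intro a b; exact le_total _ _) I.toList
  simp only [decide_eq_true_eq] at h
  exact h

omit [DecidableEq V] in
theorem indep_insert_iff {M : Matroid V} (hE : M.E = Set.univ) {I : Set V} (hI : M.Indep I) {v : V}
    (hv : v ∉ I) : M.Indep (insert v I) ↔ v ∉ M.closure I := by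
  rw [hI.insert_indep_iff_of_notMem hv, hE]
  simp

theorem test_spec {f : Finset V → ℝ} {M : Matroid V} (hE : M.E = Set.univ) {τ θ : ℝ} {σ : State V}
    (hI : M.Indep (σ.sol : Set V)) {v : V}
    (hv : θ ≤ f (insert v σ.seen) - σ.val → v ∉ σ.sol) :
    ((test τ θ σ v).eval (matroidOracle f M) = none ∧ Rejects f M τ θ σ v) ∨
    ∃ K, (test τ θ σ v).eval (matroidOracle f M) = some (σ.accept v (f (insert v σ.seen)) K) ∧
      ¬ Rejects f M τ θ σ v ∧ Keeps f M σ v K := by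
  have hval : ∀ A, matroidOracle f M (.value A) = f A := fun A => rfl
  rw [test]
  simp only [eval_ask, hval]
  split_ifs with h
  · exact Or.inl ⟨rfl, h.elim Or.inl fun h => Or.inr (Or.inl h)⟩
  push Not at h
  replace hv := hv h.2
  set m := f (insert v σ.seen) - σ.val with hm
  set l := byWeight σ.sol σ.weight with hl
  have hsub : ∀ i, ((l.take i).toFinset : Set V) ⊆ σ.sol := fun i x hx => by
    rw [Finset.mem_coe, List.mem_toFinset] at hx
    exact mem_byWeight.1 (List.mem_of_mem_take hx)
  have hcl : ∀ i, M.Indep (insert v (l.take i).toFinset : Finset V) ↔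
      v ∉ M.closure ((l.take i).toFinset : Set V) := fun i => by
    rw [Finset.coe_insert]
    exact indep_insert_iff hE (hI.subset (hsub i)) fun hx => hv (hsub i hx)
  set p : ℕ → DecisionTree (MatroidAnswer V) Bool := fun i => ask (R := MatroidAnswer V)
    (.indep (insert v (l.take i).toFinset)) fun (b : Bool) => ret b with hp
  have hpe : ∀ i, (p i).eval (matroidOracle f M) = true ↔
      v ∉ M.closure ((l.take i).toFinset : Set V) := fun i => by
    rw [← hcl i]
    exact @decide_eq_true_iff _ (Classical.propDecidable _)
  obtain ⟨-, hj, hspec⟩ := eval_binarySearch (matroidOracle f M) p 0 (l.length + 1) (by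
    intro i j _ hij _
    rw [hpe, hpe]
    refine mt fun hvi => M.closure_subset_closure (fun x hx => ?_) hvi
    rw [Finset.mem_coe, List.mem_toFinset] at hx ⊢
    exact (List.take_subset_take_left l hij) hx)
  rw [eval_bind]
  set j := (binarySearch p 0 (l.length + 1)).eval (matroidOracle f M) with hjdef
  simp only [zero_add, hpe] at hj hspec
  rcases j with _ | j
  · left
    refine ⟨rfl, Or.inr (Or.inr ?_)⟩
    have := hspec 0 le_rfl (by omega)
    simp only [lt_irrefl, iff_false, not_not, List.take_zero, List.toFinset_nil,
      Finset.coe_empty] at this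
    exact M.closure_subset_closure (Set.empty_subset _) this
  · simp only
    have h1 := (hspec j (Nat.zero_le _) (by omega)).2 (by omega)
    rcases Nat.lt_or_ge j l.length with hjl | hjl
    · rw [List.getElem?_eq_getElem hjl]
      have h2 := mt (hspec (j + 1) (Nat.zero_le _) (by omega)).1 (by omega)
      rw [not_not] at h2
      set x := l[j] with hx
      have hdec : l = l.take j ++ x :: l.drop (j + 1) := by
        rw [hx, List.getElem_cons_drop, List.take_append_drop]
      have hpw := pairwise_byWeight σ.sol σ.weight
      have hnd := nodup_byWeight σ.sol σ.weight
      rw [← hl, hdec] at hpw hnd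
      rw [List.pairwise_append] at hpw
      have hxX : x ∉ l.take j := fun h =>
        (List.nodup_append.1 hnd).2.2 x h x List.mem_cons_self rfl
      have hxsol : x ∈ σ.sol := mem_byWeight.1 (List.getElem_mem hjl)
      have hX : ∀ y ∈ l.take j, σ.weight x ≤ σ.weight y := fun y hy =>
        hpw.2.2 y hy x List.mem_cons_self
      have htake : ((l.take (j + 1)).toFinset : Set V) =
          insert x ((l.take j).toFinset : Set V) := by
        rw [List.take_succ_eq_append_getElem hjl]
        ext y
        simp only [Finset.mem_coe, List.mem_toFinset, List.mem_append, List.mem_singleton,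
          Set.mem_insert_iff]
        exact or_comm
      rw [htake] at h2
      dsimp only
      split_ifs with hw
      · right
        refine ⟨_, rfl, ?_, Or.inr ⟨x, hxsol, (l.take j).toFinset, ?_, ?_, ?_, h1, h2, hw, rfl⟩⟩
        · rintro (h' | h' | h')
          · exact absurd h' (not_lt.2 h.1)
          · exact absurd h' (not_lt.2 h.2)
          · refine h1 (M.closure_subset_closure ?_ h')
            rintro y ⟨hy, hyw⟩
            rw [Finset.mem_coe, List.mem_toFinset]
            have hyl : y ∈ l := mem_byWeight.2 hy
            rw [hdec, List.mem_append] at hyl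
            refine hyl.resolve_right fun hy' => ?_
            have : σ.weight y ≤ σ.weight x := by
              rcases List.mem_cons.1 hy' with rfl | hy'
              · exact le_rfl
              · exact (List.pairwise_cons.1 hpw.2.1).1 y hy'
            linarith
        · exact_mod_cast hsub j
        · simpa using hxX
        · simpa using hX
      · left
        refine ⟨rfl, Or.inr (Or.inr (M.closure_subset_closure ?_ h2))⟩
        rintro y (rfl | hy)
        · exact ⟨hxsol, not_le.1 hw⟩
        · have hyX : y ∈ l.take j := by simpa using hy
          exact ⟨hsub j hy, (not_le.1 hw).trans_le (by linarith [hX y hyX])⟩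
    · right
      rw [List.getElem?_eq_none hjl]
      have hall : ((l.take j).toFinset : Set V) = σ.sol := by
        rw [List.take_of_length_le hjl]
        ext y
        simp [hl, mem_byWeight]
      rw [hall] at h1
      refine ⟨_, rfl, ?_, Or.inl ⟨rfl, h1⟩⟩
      rintro (h' | h' | h')
      · exact absurd h' (not_lt.2 h.1)
      · exact absurd h' (not_lt.2 h.2)
      · exact h1 (M.closure_subset_closure (fun y hy => hy.1) h')

theorem cost_test_le {f : Finset V → ℝ} {M : Matroid V} {τ θ : ℝ} {σ : State V} {k s : ℕ}
    (hk : σ.sol.card ≤ k) (hs : k + 1 < 2 ^ s) (v : V) :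
    (test τ θ σ v).cost (matroidOracle f M) ≤ s + 2 := by
  rw [test]
  simp only [cost_ask]
  split_ifs
  · simp
  · rw [cost_bind]
    have h1 := cost_binarySearch_le (matroidOracle f M) (fun i => ask (R := MatroidAnswer V)
      (.indep (insert v ((byWeight σ.sol σ.weight).take i).toFinset)) fun (b : Bool) => ret b)
      1 s 0 ((byWeight σ.sol σ.weight).length + 1) (by simp) (by rw [length_byWeight]; omega)
    have h2 : ∀ {n m : ℕ}, n ≤ 1 * s → m = 0 → n + m + 1 + 1 ≤ s + 2 := by omega
    refine h2 h1 ?_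
    split
    · rfl
    · split
      · rfl
      · split_ifs <;> rfl

/-- The invariant of the process, where `n` bounds the number of further acceptances. The sum is a
potential that grows by at least one with each acceptance and never exceeds `T`. -/
structure Inv (f : Finset V → ℝ) (M : Matroid V) (τ θ : ℝ) (T n : ℕ) (σ : State V) : Prop where
  val_eq : σ.val = f σ.seen
  sol_subset : σ.sol ⊆ σ.seen
  indep : M.Indep (σ.sol : Set V)
  weight_mem : ∀ x ∈ σ.sol, θ ≤ σ.weight x ∧ σ.weight x ≤ τ
  potential : (T : ℝ) ≤ n + ∑ x ∈ σ.sol, (1 + Real.logb 2 (σ.weight x / θ))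
  val_le : σ.val ≤ 2 * ∑ x ∈ σ.sol, σ.weight x
  sum_le : ∀ J ⊆ σ.sol, ∑ x ∈ J, σ.weight x ≤ f J

theorem Inv.notMem_of_gain {f : Finset V → ℝ} {M : Matroid V} {τ θ : ℝ} {T n : ℕ} {σ : State V}
    (hI : Inv f M τ θ T n σ) (hθ : 0 < θ) {v : V} (h : θ ≤ f (insert v σ.seen) - σ.val) :
    v ∉ σ.sol := fun hv => by
  rw [Finset.insert_eq_of_mem (hI.sol_subset hv), hI.val_eq, sub_self] at h
  linarith

theorem Inv.test_eq_none_iff {f : Finset V → ℝ} {M : Matroid V} (hE : M.E = Set.univ) {τ θ : ℝ}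
    {T n : ℕ} {σ : State V} (hI : Inv f M τ θ T n σ) (hθ : 0 < θ) {v : V} :
    (test τ θ σ v).eval (matroidOracle f M) = none ↔ Rejects f M τ θ σ v := by
  rcases test_spec (f := f) hE (τ := τ) hI.indep (hI.notMem_of_gain hθ (v := v)) with h | ⟨K, h, h'⟩
  · exact iff_of_true h.1 h.2
  · refine iff_of_false (by simp [h]) h'.1

theorem Inv.test_eq_some {f : Finset V → ℝ} {M : Matroid V} (hE : M.E = Set.univ) {τ θ : ℝ}
    {T n : ℕ} {σ σ' : State V} (hI : Inv f M τ θ T n σ) (hθ : 0 < θ) {v : V}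
    (hs : (test τ θ σ v).eval (matroidOracle f M) = some σ') :
    f {v} ≤ τ ∧ θ ≤ f (insert v σ.seen) - σ.val ∧
      ∃ K, σ' = σ.accept v (f (insert v σ.seen)) K ∧ Keeps f M σ v K := by
  rcases test_spec (f := f) hE (τ := τ) hI.indep (hI.notMem_of_gain hθ (v := v)) with
    h | ⟨K, h, hr, hK⟩
  · simp [h.1] at hs
  · rw [h, Option.some.injEq] at hs
    exact ⟨not_lt.1 fun h => hr (Or.inl h), not_lt.1 fun h => hr (Or.inr (Or.inl h)), K,
      hs.symm, hK⟩

theorem Keeps.subset {f : Finset V → ℝ} {M : Matroid V} {σ : State V} {v : V} {K : Finset V}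
    (h : Keeps f M σ v K) : K ⊆ σ.sol := by
  rcases h with ⟨rfl, -⟩ | ⟨x, -, X, -, -, -, -, -, -, rfl⟩
  · exact subset_rfl
  · exact Finset.erase_subset _ _

theorem Keeps.indep {f : Finset V → ℝ} {M : Matroid V} (hE : M.E = Set.univ) {σ : State V} {v : V}
    {K : Finset V} (h : Keeps f M σ v K) (hI : M.Indep (σ.sol : Set V)) (hv : v ∉ σ.sol) :
    M.Indep (insert v K : Finset V) := by
  rw [Finset.coe_insert, indep_insert_iff hE (hI.subset (by exact_mod_cast h.subset))
    fun hvK => hv (h.subset hvK)]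
  rcases h with ⟨rfl, h⟩ | ⟨x, hx, X, hX, hxX, -, h1, h2, -, rfl⟩
  · exact h
  · intro hcl
    rw [Finset.coe_erase] at hcl
    have hXs : (X : Set V) ⊆ (σ.sol : Set V) \ {x} := fun y hy =>
      ⟨hX hy, fun hyx => hxX (Set.mem_singleton_iff.1 hyx ▸ hy)⟩
    have h3 : x ∈ M.closure (insert v (X : Set V)) := (M.closure_exchange ⟨h2, h1⟩).1
    refine hI.notMem_closure_sdiff_of_mem hx ?_
    have h4 : M.closure (insert v (X : Set V)) ⊆ M.closure ((σ.sol : Set V) \ {x}) := by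
      refine M.closure_subset_closure_of_subset_closure ?_
      rintro y (rfl | hy)
      · exact hcl
      · exact M.mem_closure_of_mem (hXs hy) (by rw [hE]; exact Set.subset_univ _)
    exact h4 h3

theorem sum_update_insert {K : Finset V} {v : V} (hv : v ∉ K) (w : V → ℝ) (a : ℝ) (F : ℝ → ℝ) :
    ∑ x ∈ insert v K, F (Function.update w v a x) = F a + ∑ x ∈ K, F (w x) := by
  rw [Finset.sum_insert hv, Function.update_self]
  congr 1
  refine Finset.sum_congr rfl fun x hx => ?_
  rw [Function.update_of_ne (by rintro rfl; exact hv hx)]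

omit [DecidableEq V] in
theorem card_le_of_indep {M : Matroid V} {k : ℕ} (hM : M.eRank = k) {I : Finset V}
    (hI : M.Indep (I : Set V)) : I.card ≤ k := by
  have h := hI.encard_le_eRank
  rw [hM, Set.encard_coe_eq_coe_finsetCard] at h
  exact_mod_cast h

omit [DecidableEq V] in
theorem sum_potential_le {M : Matroid V} {k T : ℕ} (hM : M.eRank = k) {τ θ : ℝ}
    (hθ : 0 < θ) (hτ : θ ≤ τ) (hT : k * (1 + Real.logb 2 (τ / θ)) ≤ T) {I : Finset V}
    (hI : M.Indep (I : Set V)) {w : V → ℝ} (hw : ∀ x ∈ I, θ ≤ w x ∧ w x ≤ τ) :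
    ∑ x ∈ I, (1 + Real.logb 2 (w x / θ)) ≤ T := by
  have h1 : ∀ x ∈ I, 1 + Real.logb 2 (w x / θ) ≤ 1 + Real.logb 2 (τ / θ) := fun x hx => by
    have : 0 < w x := hθ.trans_le (hw x hx).1
    gcongr
    · norm_num
    · exact (hw x hx).2
  refine (Finset.sum_le_card_nsmul _ _ _ h1).trans (le_trans ?_ hT)
  rw [nsmul_eq_mul]
  have h2 : 0 ≤ Real.logb 2 (τ / θ) := Real.logb_nonneg (by norm_num) ((one_le_div hθ).2 hτ)
  exact mul_le_mul_of_nonneg_right (by exact_mod_cast card_le_of_indep hM hI) (by linarith)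

theorem Inv.accept {f : Finset V → ℝ} (hf : IsMonotoneSubmodular f) {M : Matroid V}
    (hE : M.E = Set.univ) {k T n : ℕ} (hM : M.eRank = k) {τ θ : ℝ} (hθ : 0 < θ) (hτ : θ ≤ τ)
    (hT : k * (1 + Real.logb 2 (τ / θ)) ≤ T) {σ : State V} (hI : Inv f M τ θ T n σ) {v : V}
    {K : Finset V} (hvτ : f {v} ≤ τ) (hgain : θ ≤ f (insert v σ.seen) - σ.val)
    (hK : Keeps f M σ v K) :
    ∃ m, n = m + 1 ∧ Inv f M τ θ T m (σ.accept v (f (insert v σ.seen)) K) := by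
  have hv := hI.notMem_of_gain hθ hgain
  have hvK : v ∉ K := fun h => hv (hK.subset h)
  set g := f (insert v σ.seen) - σ.val with hg
  have hg0 : 0 < g := hθ.trans_le hgain
  have hgτ : g ≤ τ := by
    have := hf.gain_le_singleton σ.seen v
    rw [← hI.val_eq] at this
    exact this.trans hvτ
  have hweight : ∀ x ∈ insert v K, θ ≤ Function.update σ.weight v g x ∧
      Function.update σ.weight v g x ≤ τ := by
    intro x hx
    rcases Finset.mem_insert.1 hx with rfl | hxK
    · rw [Function.update_self]
      exact ⟨hgain, hgτ⟩
    · rw [Function.update_of_ne (by rintro rfl; exact hvK hxK)]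
      exact hI.weight_mem x (hK.subset hxK)
  have hpot : ∑ x ∈ σ.sol, (1 + Real.logb 2 (σ.weight x / θ)) + 1 ≤
      ∑ x ∈ insert v K, (1 + Real.logb 2 (Function.update σ.weight v g x / θ)) := by
    rw [sum_update_insert hvK σ.weight g fun y => 1 + Real.logb 2 (y / θ)]
    rcases hK with ⟨rfl, -⟩ | ⟨x, hx, X, -, -, -, -, -, hxg, rfl⟩
    · have : 0 ≤ Real.logb 2 (g / θ) := Real.logb_nonneg (by norm_num) ((one_le_div hθ).2 hgain)
      linarith
    · rw [← Finset.add_sum_erase _ _ hx]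
      have hx0 : 0 < σ.weight x := hθ.trans_le (hI.weight_mem x hx).1
      have h1 : Real.logb 2 (2 * (σ.weight x / θ)) ≤ Real.logb 2 (g / θ) := by
        refine Real.logb_le_logb_of_le (by norm_num) (by positivity) ?_
        rw [← mul_div_assoc]
        gcongr
      rw [Real.logb_mul (by norm_num) (by positivity), Real.logb_self_eq_one (by norm_num)] at h1
      linarith
  have hindep := hK.indep hE hI.indep hv
  have hle := sum_potential_le hM hθ hτ hT hindep hweight
  have hn : 1 ≤ n := by
    have : (1 : ℝ) ≤ n := by linarith [hI.potential]
    exact_mod_cast this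
  refine ⟨n - 1, by omega, rfl, ?_, hindep, hweight, ?_, ?_, ?_⟩
  · exact Finset.insert_subset_insert _ (hK.subset.trans hI.sol_subset)
  · rw [Nat.cast_sub hn, Nat.cast_one]
    have h1 := hI.potential
    simp only [State.accept]
    linarith
  · simp only [State.accept]
    rw [sum_update_insert hvK σ.weight _ fun y => y, ← hg]
    have h1 := hI.val_le
    have h2 : f (insert v σ.seen) = σ.val + g := by rw [hg]; ring
    rw [h2]
    rcases hK with ⟨rfl, -⟩ | ⟨x, hx, X, -, -, -, -, -, hxg, rfl⟩
    · linarith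
    · rw [← Finset.add_sum_erase _ _ hx] at h1
      linarith
  · intro J hJ
    simp only [State.accept] at hJ ⊢
    by_cases hvJ : v ∈ J
    · have hJK : J.erase v ⊆ K := fun x hx => by
        rw [Finset.mem_erase] at hx
        exact (Finset.mem_insert.1 (hJ hx.2)).resolve_left hx.1
      rw [← Finset.insert_erase hvJ,
        sum_update_insert (Finset.notMem_erase _ _) σ.weight _ fun y => y]
      have h1 := hI.sum_le _ (hJK.trans hK.subset)
      have h2 := hf.gain_anti ((hJK.trans hK.subset).trans hI.sol_subset) v
      rw [← hI.val_eq] at h2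
      linarith
    · have hJK : J ⊆ K := fun x hx =>
        (Finset.mem_insert.1 (hJ hx)).resolve_left (by rintro rfl; exact hvJ hx)
      refine le_trans (le_of_eq ?_) (hI.sum_le J (hJK.trans hK.subset))
      refine Finset.sum_congr rfl fun x hx => ?_
      rw [Function.update_of_ne (by rintro rfl; exact hvJ hx)]

theorem Rejects.accept {f : Finset V → ℝ} (hf : IsMonotoneSubmodular f) {M : Matroid V}
    (hE : M.E = Set.univ) {T n : ℕ} {τ θ : ℝ} (hθ : 0 < θ) {σ : State V} (hI : Inv f M τ θ T n σ)
    {v e : V} {K : Finset V} (he : θ ≤ f (insert e σ.seen) - σ.val) (hK : Keeps f M σ e K)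
    (hv : Rejects f M τ θ σ v) : Rejects f M τ θ (σ.accept e (f (insert e σ.seen)) K) v := by
  have heS := hI.notMem_of_gain hθ he
  have hanti := hf.gain_anti (Finset.subset_insert e σ.seen) v
  rw [← hI.val_eq] at hanti
  rcases hv with hv | hv | hv
  · exact Or.inl hv
  · exact Or.inr (Or.inl (hanti.trans_lt hv))
  · refine Or.inr (Or.inr ?_)
    have hground : ∀ X : Set V, X ⊆ M.E := fun X => by rw [hE]; exact Set.subset_univ _
    refine M.closure_subset_closure_of_subset_closure ?_ hv
    rintro y ⟨hy, hyw⟩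
    have hkeep : ∀ z ∈ K, f (insert v σ.seen) - σ.val < 2 * σ.weight z →
        z ∈ {z | z ∈ (σ.accept e (f (insert e σ.seen)) K).sol ∧
          f (insert v (σ.accept e (f (insert e σ.seen)) K).seen) -
            (σ.accept e (f (insert e σ.seen)) K).val <
          2 * (σ.accept e (f (insert e σ.seen)) K).weight z} := by
      intro z hz hzw
      refine ⟨Finset.mem_insert_of_mem hz, hanti.trans_lt ?_⟩
      simp only [State.accept]
      rwa [Function.update_of_ne (by rintro rfl; exact heS (hK.subset hz))]
    by_cases hyK : y ∈ K
    · exact M.mem_closure_of_mem (hkeep y hyK hyw) (hground _)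
    -- otherwise `y` has been replaced by `e`, and it depends on `e` and on heavier elements
    rcases hK with ⟨rfl, -⟩ | ⟨x, hx, X, hX, hxX, hXw, h1, h2, h3, rfl⟩
    · exact absurd hy hyK
    obtain rfl : y = x := by
      by_contra hne
      exact hyK (Finset.mem_erase.2 ⟨hne, hy⟩)
    refine M.closure_subset_closure ?_ (M.closure_exchange ⟨h2, h1⟩).1
    rintro z (rfl | hz)
    · refine ⟨Finset.mem_insert_self _ _, hanti.trans_lt ?_⟩
      simp only [State.accept, Function.update_self]
      linarith
    · refine hkeep z (Finset.mem_erase.2 ⟨by rintro rfl; exact hxX hz, hX hz⟩) ?_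
      have := hXw z hz
      linarith

theorem isFilterProcess {f : Finset V → ℝ} (hf : IsMonotoneSubmodular f) {M : Matroid V}
    (hE : M.E = Set.univ) {k T : ℕ} (hM : M.eRank = k) {τ θ : ℝ} (hθ : 0 < θ) (hτ : θ ≤ τ)
    (hT : k * (1 + Real.logb 2 (τ / θ)) ≤ T) :
    IsFilterProcess (fun σ v => (test τ θ σ v).eval (matroidOracle f M)) (Inv f M τ θ T) where
  next := by
    intro n σ v σ' hI hs
    obtain ⟨h1, h2, K, rfl, hK⟩ := hI.test_eq_some hE hθ hs
    exact hI.accept hf hE hM hθ hτ hT h1 h2 hK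
  reject_of_reject := by
    intro n σ v w σ' hI hs hv
    obtain ⟨h1, h2, K, rfl, hK⟩ := hI.test_eq_some hE hθ hs
    obtain ⟨m, -, hI'⟩ := hI.accept hf hE hM hθ hτ hT h1 h2 hK
    rw [hI.test_eq_none_iff hE hθ] at hv
    rw [hI'.test_eq_none_iff hE hθ]
    exact hv.accept hf hE hθ hI h2 hK
  reject_of_accept := by
    intro n σ v σ' hI hs
    obtain ⟨h1, h2, K, rfl, hK⟩ := hI.test_eq_some hE hθ hs
    obtain ⟨m, -, hI'⟩ := hI.accept hf hE hM hθ hτ hT h1 h2 hK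
    rw [hI'.test_eq_none_iff hE hθ]
    refine Or.inr (Or.inl ?_)
    simpa [State.accept] using hθ

end MatroidConstraint

/-! ### Matroid constraint: approximation and complexity -/

namespace MatroidConstraint

open DecisionTree

variable {V : Type u} [DecidableEq V]

/-- If every element `v` of an independent set `B` depends on those elements of `I` whose doubled
weight exceeds `g v`, then `B` can be matched into `I` along such pairs, by Hall's theorem: the
elements of a subset of `B` all depend on the neighbours of its element with minimal `g`. -/
theorem sum_le_two_mul_sum_weight {M : Matroid V} {I B : Finset V} (hB : M.Indep (B : Set V))
    {g w : V → ℝ} (hw : ∀ x ∈ I, 0 ≤ w x)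
    (h : ∀ v ∈ B, v ∈ M.closure {y | y ∈ I ∧ g v < 2 * w y}) :
    ∑ v ∈ B, g v ≤ 2 * ∑ x ∈ I, w x := by
  set t : B → Finset V := fun v => I.filter fun y => g v < 2 * w y with ht
  have hall : ∀ s : Finset B, s.card ≤ (s.biUnion t).card := by
    intro s
    rcases s.eq_empty_or_nonempty with rfl | hs
    · simp
    obtain ⟨v, hv, hmin⟩ := s.exists_min_image (fun v => g v) hs
    have h1 : ((s.map (Function.Embedding.subtype _) : Finset V) : Set V) ⊆
        M.closure (t v : Set V) := by
      intro u hu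
      simp only [Finset.coe_map, Set.mem_image, Finset.mem_coe] at hu
      obtain ⟨u, hu, rfl⟩ := hu
      refine M.closure_subset_closure ?_ (h u u.2)
      rintro y ⟨hy, hyw⟩
      exact Finset.mem_coe.2 (Finset.mem_filter.2 ⟨hy, (hmin u hu).trans_lt hyw⟩)
    have h2 : M.Indep ((s.map (Function.Embedding.subtype _) : Finset V) : Set V) := by
      refine hB.subset fun u hu => ?_
      simp only [Finset.coe_map, Set.mem_image, Finset.mem_coe] at hu
      obtain ⟨u, -, rfl⟩ := hu
      exact u.2
    have h3 := h2.encard_le_eRk_of_subset h1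
    rw [M.eRk_closure_eq] at h3
    have h4 := h3.trans (M.eRk_le_encard _)
    rw [Set.encard_coe_eq_coe_finsetCard, Set.encard_coe_eq_coe_finsetCard, Finset.card_map] at h4
    exact (by exact_mod_cast h4 : s.card ≤ (t v).card).trans
      (Finset.card_le_card (Finset.subset_biUnion_of_mem t hv))
  obtain ⟨φ, hφ, hφt⟩ := (Finset.all_card_le_biUnion_card_iff_exists_injective t).1 hall
  calc ∑ v ∈ B, g v = ∑ v : B, g v := (Finset.sum_coe_sort B g).symm
    _ ≤ ∑ v : B, 2 * w (φ v) :=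
        Finset.sum_le_sum fun v _ => (Finset.mem_filter.1 (hφt v)).2.le
    _ = ∑ x ∈ Finset.univ.image φ, 2 * w x := by
        rw [Finset.sum_image fun a _ b _ hab => hφ hab]
    _ ≤ ∑ x ∈ I, 2 * w x := by
        refine Finset.sum_le_sum_of_subset_of_nonneg ?_ fun x hx _ => by linarith [hw x hx]
        intro x hx
        obtain ⟨v, -, rfl⟩ := Finset.mem_image.1 hx
        exact (Finset.mem_filter.1 (hφt v)).1
    _ = 2 * ∑ x ∈ I, w x := by rw [Finset.mul_sum]

/-- The threshold for the guess `2 ^ i`, which is intended to exceed the largest value of an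
element of an optimal solution by a factor of at most `2`. -/
noncomputable def threshold (k : ℕ) (ε : ℝ) (i : ℤ) : ℝ := 2 ^ i / (10 * k / ε)

/-- The exchange processes for all guesses. The value of a state is the total weight of its
solution. -/
noncomputable def process (V : Type u) [DecidableEq V] (k : ℕ) (ε : ℝ) :
    GuessedProcess (MatroidAnswer V) V (State V) ℤ where
  test i := test (2 ^ i) (threshold k ε i)
  guesses v := ask (R := MatroidAnswer V) (.value {v}) fun (a : ℝ) =>
    ret (guessWindow 2 (10 * k / ε) a)
  start := ⟨∅, 0, ∅, 0⟩
  solution σ := σ.sol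
  value σ := ∑ x ∈ σ.sol, σ.weight x

/-- A bound on the number of levels: each of the `k` elements of the solution can increase its
weight by a factor of at most `10 * k / ε`, at least doubling it at each exchange. -/
noncomputable def levelBound (k : ℕ) (ε : ℝ) : ℕ := ⌈k * (1 + Real.logb 2 (10 * k / ε))⌉₊

section

variable {f : Finset V → ℝ} (hf : IsMonotoneSubmodular f) {M : Matroid V} (hE : M.E = Set.univ)
  {k : ℕ} (hM : M.eRank = k) (hk : 1 ≤ k) {ε : ℝ} (hε : 0 < ε) (hε1 : ε ≤ 1)
include hk hε

omit [DecidableEq V] in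
theorem threshold_pos (i : ℤ) : 0 < threshold k ε i := by
  have : (0 : ℝ) < k := by exact_mod_cast hk
  rw [threshold]
  positivity

include hε1

theorem one_le_ratio : 1 ≤ 10 * k / ε := by
  have : (1 : ℝ) ≤ k := by exact_mod_cast hk
  rw [one_le_div hε]
  linarith

include hf hE hM

theorem isEfficient :
    (process V k ε).IsEfficient (matroidOracle f M)
      (fun i => Inv f M (2 ^ i) (threshold k ε i) (levelBound k ε)) (levelBound k ε)
      (Nat.log 2 (k + 1) + 3) 1 ⌊Real.logb 2 (10 * k / ε) + 1⌋₊ where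
  isFilterProcess i := by
    have h1 := one_le_ratio hk hε hε1
    refine isFilterProcess hf hE hM (threshold_pos hk hε i) ?_ ?_
    · exact div_le_self (by positivity) h1
    · have : (2 : ℝ) ^ i / threshold k ε i = 10 * k / ε := by
        rw [threshold, div_div_cancel₀ (by positivity)]
      rw [this]
      exact Nat.le_ceil _
  start i := by
    refine ⟨hf.map_empty.symm, by simp [process], by simp [process], by simp [process],
      by simp [process], by simp [process], fun J hJ => ?_⟩
    have : J = ∅ := Finset.subset_empty.1 hJ
    simp [this, hf.map_empty]
  cost_test i n σ v hI :=
    cost_test_le (card_le_of_indep hM hI.indep) (Nat.lt_pow_succ_log_self one_lt_two _) v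
  cost_guesses v := by simp [process]
  card_guesses v := card_guessWindow_le one_lt_two (one_le_ratio hk hε hε1) _

/-- In each process, the final value is at least a quarter of the value of any independent set, up
to the elements whose gain is below the threshold. -/
theorem le_four_mul_value {N : ℕ} (p : V ≃ Fin N) (W : Finset V) {i : ℤ} {σ : State V}
    (hσ : σ = finalState (process V k ε).start
      ((process V k ε).structures (matroidOracle f M) p W i)) {n : ℕ}
    (hI : Inv f M (2 ^ i) (threshold k ε i) (levelBound k ε) n σ) {J : Finset V} (hJW : J ⊆ W)
    (hJ : M.Indep (J : Set V)) (hi : ∀ v ∈ J, f {v} ≤ 2 ^ i) :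
    f J ≤ 4 * (process V k ε).value σ + k * threshold k ε i := by
  have hE' := isEfficient hf hE hM hk hε hε1
  have hθ := threshold_pos hk hε i
  have hK := one_le_ratio hk hε hε1
  set g : V → ℝ := fun v => f (insert v σ.seen) - f σ.seen with hg
  have hcases : ∀ v ∈ J, g v < threshold k ε i ∨
      v ∈ M.closure {y | y ∈ σ.sol ∧ g v < 2 * σ.weight y} := by
    intro v hv
    have hsing := hf.gain_le_singleton σ.seen v
    by_cases hpart : i ∈ guessWindow 2 (10 * k / ε) (f {v})
    · have hrej := reject_finalState (p := p) (σ₀ := (process V k ε).start)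
        (hE'.isFilterProcess i) (hE'.start i) (v := v)
        (A := (process V k ε).participants (matroidOracle f M) W i)
        (Or.inl (Finset.mem_filter.2 ⟨hJW hv, hpart⟩))
      rw [← GuessedProcess.structures, ← hσ] at hrej
      have hrej := (hI.test_eq_none_iff hE hθ).1 hrej
      rw [Rejects, hI.val_eq] at hrej
      exact hrej.resolve_left (not_lt.2 (hi v hv))
    · left
      rcases (hf.nonneg {v}).eq_or_lt with hv0 | hv0
      · exact hsing.trans_lt (hv0 ▸ hθ)
      · rw [mem_guessWindow one_lt_two (by linarith) hv0, not_and, not_le] at hpart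
        refine hsing.trans_lt ?_
        rw [threshold, lt_div_iff₀ (by linarith), mul_comm]
        exact hpart (hi v hv)
  classical
  have hsum := hf.le_add_sum_gain σ.seen J
  rw [← Finset.sum_filter_add_sum_filter_not (J \ σ.seen) fun v => g v < threshold k ε i] at hsum
  have hsmall := Finset.sum_le_card_nsmul ((J \ σ.seen).filter fun v => g v < threshold k ε i) g
    (threshold k ε i) fun v hv => (Finset.mem_filter.1 hv).2.le
  have hcard : (((J \ σ.seen).filter fun v => g v < threshold k ε i).card : ℝ) ≤ k := by
    exact_mod_cast (Finset.card_le_card ((Finset.filter_subset _ _).trans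
      Finset.sdiff_subset)).trans (card_le_of_indep hM hJ)
  rw [nsmul_eq_mul] at hsmall
  have hsmall' := mul_le_mul_of_nonneg_right hcard hθ.le
  have hlarge := sum_le_two_mul_sum_weight (M := M) (I := σ.sol)
    (B := (J \ σ.seen).filter fun v => ¬ g v < threshold k ε i) (g := g) (w := σ.weight)
    (hJ.subset fun v hv => (Finset.mem_sdiff.1 (Finset.mem_filter.1 hv).1).1)
    (fun x hx => hθ.le.trans (hI.weight_mem x hx).1) (fun v hv => by
      rw [Finset.mem_filter, Finset.mem_sdiff] at hv
      exact (hcases v hv.1.1).resolve_left hv.2)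
  have hval := hI.val_le
  rw [hI.val_eq] at hval
  change f J ≤ 4 * ∑ x ∈ σ.sol, σ.weight x + _
  linarith

theorem isApproxSolution [Finite V] {N : ℕ} (p : V ≃ Fin N) (W : Finset V) :
    IsApproxSolution f (fun I => M.Indep (I : Set V)) W (4 + ε)
      ((process V k ε).bestSolution
        ((process V k ε).structures (matroidOracle f M) p W)) := by
  classical
  have := Fintype.ofFinite V
  have hk' : (0 : ℝ) < k := by exact_mod_cast hk
  have hE' := isEfficient hf hE hM hk hε hε1
  have hfin : ∀ i, ∃ n, Inv f M (2 ^ i) (threshold k ε i) (levelBound k ε) n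
      (finalState (process V k ε).start
        ((process V k ε).structures (matroidOracle f M) p W i)) := fun i =>
    finalState_levels_induction
      (J := fun σ => ∃ n, Inv f M (2 ^ i) (threshold k ε i) (levelBound k ε) n σ)
      ⟨_, hE'.start i⟩ fun σ v σ' _ ⟨n, hn⟩ hs => by
        obtain ⟨m, -, hm⟩ := (hE'.isFilterProcess i).next hn hs
        exact ⟨m, hm⟩
  have hsub : ∀ i, (finalState (process V k ε).start
      ((process V k ε).structures (matroidOracle f M) p W i)).seen ⊆ W := fun i => by
    refine (finalState_levels_induction (J := fun σ : State V =>
      (∃ n, Inv f M (2 ^ i) (threshold k ε i) (levelBound k ε) n σ) ∧ σ.seen ⊆ W)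
      ⟨⟨_, hE'.start i⟩, by simp [process]⟩ ?_).2
    rintro σ v σ' hv ⟨⟨n, hn⟩, hW⟩ hs
    obtain ⟨m, -, hm⟩ := (hE'.isFilterProcess i).next hn hs
    obtain ⟨-, -, K, rfl, -⟩ := hn.test_eq_some hE (threshold_pos hk hε i) hs
    exact ⟨⟨m, hm⟩, Finset.insert_subset (Finset.filter_subset _ _ hv) hW⟩
  refine GuessedProcess.isApproxSolution_bestSolution (by linarith) p W (fun i => ?_) ?_
  · obtain ⟨n, hn⟩ := hfin i
    exact ⟨hn.sol_subset.trans (hsub i), hn.indep, hn.sum_le _ subset_rfl⟩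
  have hvalue : ∀ i, 0 ≤ (process V k ε).value (finalState (process V k ε).start
      ((process V k ε).structures (matroidOracle f M) p W i)) := fun i => by
    obtain ⟨n, hn⟩ := hfin i
    exact Finset.sum_nonneg fun x hx => (threshold_pos hk hε i).le.trans (hn.weight_mem x hx).1
  intro J hJW hJ
  obtain ⟨J₀, hJ₀, hmax⟩ :=
    (W.powerset.filter fun J : Finset V => M.Indep (J : Set V)).exists_max_image f ⟨∅, by simp⟩
  simp only [Finset.mem_filter, Finset.mem_powerset] at hJ₀ hmax
  have hJJ₀ := hmax J ⟨hJW, hJ⟩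
  rcases (hf.nonneg J₀).eq_or_lt with h0 | hpos
  · refine ⟨0, ?_⟩
    rw [← h0] at hJJ₀
    exact hJJ₀.trans (mul_nonneg (by linarith) (hvalue 0))
  obtain ⟨v₀, hv₀, hvmax⟩ := J₀.exists_max_image (fun v => f {v}) (by
    rw [Finset.nonempty_iff_ne_empty]
    rintro rfl
    exact hpos.ne' hf.map_empty)
  have hv₀pos : 0 < f {v₀} := by
    by_contra! hle
    have h1 := hf.le_add_sum_gain ∅ J₀
    have h2 : ∑ e ∈ J₀ \ ∅, (f (insert e ∅) - f ∅) ≤ 0 := by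
      refine Finset.sum_nonpos fun e he => ?_
      rw [Finset.sdiff_empty] at he
      exact (hf.gain_le_singleton ∅ e).trans ((hvmax e he).trans hle)
    rw [hf.map_empty] at h1 h2
    linarith
  obtain ⟨n, hn⟩ := exists_mem_Ioc_zpow hv₀pos (one_lt_two (α := ℝ))
  refine ⟨n + 1, ?_⟩
  obtain ⟨m, hm⟩ := hfin (n + 1)
  have hmain := le_four_mul_value hf hE hM hk hε hε1 p W rfl hm hJ₀.1 hJ₀.2
    fun v hv => (hvmax v hv).trans hn.2
  set X := (process V k ε).value (finalState (process V k ε).start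
      ((process V k ε).structures (matroidOracle f M) p W (n + 1))) with hX
  have hsingle : f {v₀} ≤ f J₀ := hf.mono _ _ (Finset.singleton_subset_iff.2 hv₀)
  have hθ : k * threshold k ε (n + 1) = 2 ^ n * ε / 5 := by
    rw [threshold, zpow_add_one₀ two_ne_zero]
    field_simp
    ring
  rw [hθ] at hmain
  have h1 : 2 ^ n * ε ≤ f J₀ * ε := by
    have := hn.1
    gcongr
    linarith
  have h2 : f J₀ * (1 - ε / 5) ≤ 4 * X := by linarith
  have h3 : f J₀ * 4 ≤ f J₀ * ((1 - ε / 5) * (4 + ε)) :=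
    mul_le_mul_of_nonneg_left (by nlinarith) hpos.le
  nlinarith

end

theorem complexity_bound {k : ℕ} (hk : 1 ≤ k) {ε : ℝ} (hε : 0 < ε) (hε1 : ε ≤ 1) :
    ((1 : ℕ) + ⌊Real.logb 2 (10 * k / ε) + 1⌋₊ * ((Nat.log 2 (k + 1) + 3 : ℕ) *
      ((Nat.log 2 (levelBound k ε + 1) + 1 : ℕ) + 1) * (1 + levelBound k ε)) : ℝ) ≤
        15000 * (k * Real.log (k + 1) * Real.log ((k + 1) / ε) ^ 3) := by
  have hk' : (1 : ℝ) ≤ k := by exact_mod_cast hk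
  have hlog2 := Real.log_two_gt_d9
  have hratio := one_le_ratio hk hε hε1
  set L := Real.log (k + 1) with hL
  set Λ := Real.log ((k + 1) / ε) with hΛ
  have hL2 : Real.log 2 ≤ L := Real.log_le_log (by norm_num) (by linarith)
  have hq : (k + 1 : ℝ) ≤ (k + 1) / ε := by
    rw [le_div_iff₀ hε]
    nlinarith
  have hLΛ : L ≤ Λ := Real.log_le_log (by linarith) hq
  have hL0 : 0 < L := by linarith
  have hΛ0 : 0 < Λ := by linarith
  have hlogb : Real.logb 2 (10 * k / ε) ≤ 8 * Λ := by
    have h1 : Real.log (10 * k / ε) ≤ Real.log (2 ^ 4 * ((k + 1) / ε)) := by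
      refine Real.log_le_log (by positivity) ?_
      rw [mul_div_assoc]
      have : (k : ℝ) / ε ≤ (k + 1) / ε := by gcongr; linarith
      have h0 : 0 ≤ (k : ℝ) / ε := by positivity
      linarith
    rw [Real.log_mul (by norm_num) (by positivity), Real.log_pow, ← hΛ] at h1
    rw [Real.logb, div_le_iff₀ (by linarith)]
    push_cast at h1
    nlinarith
  have hlogb0 : 0 ≤ Real.logb 2 (10 * k / ε) := Real.logb_nonneg (by norm_num) hratio
  have hg : (⌊Real.logb 2 (10 * k / ε) + 1⌋₊ : ℝ) ≤ 10 * Λ :=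
    (Nat.floor_le (by linarith)).trans (by linarith)
  have hT : (1 + levelBound k ε : ℝ) ≤ 14 * (k * Λ) := by
    have h1 := Nat.ceil_lt_add_one (a := k * (1 + Real.logb 2 (10 * k / ε))) (by positivity)
    have h2 : k * (1 + Real.logb 2 (10 * k / ε)) ≤ k * (10 * Λ) := by gcongr; linarith
    have h3 : 1 * Λ ≤ k * Λ := by gcongr
    rw [levelBound]
    linarith
  have hc : ((Nat.log 2 (k + 1) + 3 : ℕ) : ℝ) ≤ 8 * L := by
    have h1 : ((Nat.log 2 (k + 1) : ℕ) : ℝ) ≤ Real.logb 2 ((k + 1 : ℕ) : ℝ) :=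
      Real.natLog_le_logb _ _
    rw [Real.logb, le_div_iff₀ (by linarith)] at h1
    push_cast at h1 ⊢
    rw [← hL] at h1
    have h2 : (0 : ℝ) ≤ Nat.log 2 (k + 1) := by positivity
    nlinarith
  have hs : ((Nat.log 2 (levelBound k ε + 1) + 1 : ℕ) + 1 : ℝ) ≤ 13 * Λ := by
    have h1 : ((Nat.log 2 (levelBound k ε + 1) : ℕ) : ℝ) ≤
        Real.logb 2 ((levelBound k ε + 1 : ℕ) : ℝ) := Real.natLog_le_logb _ _
    have h2 : Real.log ((levelBound k ε + 1 : ℕ) : ℝ) ≤ 4 * Real.log 2 + 2 * Λ := by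
      have hq0 : 0 < (k + 1) / ε := by positivity
      have h3 : ((levelBound k ε + 1 : ℕ) : ℝ) ≤ 2 ^ 4 * ((k + 1) / ε) ^ 2 := by
        have h4 : Λ ≤ (k + 1) / ε := (Real.log_le_sub_one_of_pos hq0).trans (by linarith)
        have h5 : k * Λ ≤ (k + 1) / ε * ((k + 1) / ε) :=
          mul_le_mul (by linarith) h4 hΛ0.le hq0.le
        push_cast
        nlinarith
      refine (Real.log_le_log (by positivity) h3).trans (le_of_eq ?_)
      rw [Real.log_mul (by norm_num) (by positivity), Real.log_pow, Real.log_pow]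
      push_cast
      rfl
    rw [Real.logb, le_div_iff₀ (by linarith)] at h1
    push_cast at h1 h2 ⊢
    have h3 : (0 : ℝ) ≤ Nat.log 2 (levelBound k ε + 1) := by positivity
    nlinarith
  have h1 : (⌊Real.logb 2 (10 * k / ε) + 1⌋₊ * ((Nat.log 2 (k + 1) + 3 : ℕ) *
      ((Nat.log 2 (levelBound k ε + 1) + 1 : ℕ) + 1) * (1 + levelBound k ε)) : ℝ) ≤
      10 * Λ * (8 * L * (13 * Λ) * (14 * (k * Λ))) := by
    refine mul_le_mul hg (mul_le_mul (mul_le_mul hc hs ?_ ?_) hT ?_ ?_) ?_ ?_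
    all_goals positivity
  have h2 : 1 ≤ 16 * (k * L * Λ ^ 3) := by
    have h3 : 1 ≤ 2 * L := by linarith
    have h4 : 1 ≤ (2 * Λ) ^ 3 := one_le_pow₀ (by linarith)
    have h5 := one_le_mul_of_one_le_of_one_le hk' (one_le_mul_of_one_le_of_one_le h3 h4)
    linarith
  have h3 : 10 * Λ * (8 * L * (13 * Λ) * (14 * (k * Λ))) = 14560 * (k * L * Λ ^ 3) := by ring
  push_cast at h1 h3 ⊢
  linarith

end MatroidConstraint

theorem exists_matroid_algorithm (V : Type u) [Finite V] [DecidableEq V] (k : ℕ) {ε : ℝ}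
    (hε : 0 < ε) (hε1 : ε ≤ 1) :
    ∃ alg : DynamicAlgorithm V (MatroidAnswer V),
      ∀ (f : Finset V → ℝ) (M : Matroid V), IsMonotoneSubmodular f →
        M.E = Set.univ → M.eRank = (k : ℕ∞) → ∀ S : List (Update V),
          alg.Maintains (matroidOracle f M) f (fun I => M.Indep (I : Set V)) (4 + ε) S ∧
          alg.QueryComplexityLE (matroidOracle f M) S
            (15000 * (k * Real.log (k + 1) * Real.log ((k + 1) / ε) ^ 3)) := by
  rcases Nat.eq_zero_or_pos k with rfl | hk
  · refine ⟨trivialAlgorithm V _, fun f M hf _ hM S => ⟨trivialAlgorithm_maintains _ _ hf.map_empty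
      (by simp) (fun J hJ => ?_) S, trivialAlgorithm_queryComplexityLE _ _ S⟩⟩
    exact Finset.card_eq_zero.1 (Nat.le_zero.1 (MatroidConstraint.card_le_of_indep hM hJ))
  have := Fintype.ofFinite V
  obtain ⟨N, m, ⟨E⟩⟩ := exists_enumeration V
  refine ⟨(MatroidConstraint.process V k ε).algorithm E, fun f M hf hE hM S => ⟨?_, ?_⟩⟩
  · refine GuessedProcess.maintains E (MatroidConstraint.isEfficient hf hE hM hk hε hε1) ?_
      (fun p W => MatroidConstraint.isApproxSolution hf hE hM hk hε hε1 p W) S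
    refine ⟨subset_rfl, by simp, fun J hJ _ => ?_⟩
    rw [Finset.subset_empty.1 hJ, hf.map_empty, mul_zero]
  · exact GuessedProcess.queryComplexityLE E (MatroidConstraint.isEfficient hf hE hM hk hε hε1)
      (Nat.lt_pow_succ_log_self one_lt_two _)
      (MatroidConstraint.complexity_bound hk hε hε1) S

theorem theorem1 :
    -- matroid constraint
    (∃ C : ℝ, 0 < C ∧
      ∀ (V : Type u) [Finite V] [DecidableEq V] (k : ℕ) (ε : ℝ), 0 < ε → ε ≤ 1 →
        ∃ alg : DynamicAlgorithm V (MatroidAnswer V),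
          ∀ (f : Finset V → ℝ) (M : Matroid V), IsMonotoneSubmodular f →
            M.E = Set.univ → M.eRank = (k : ℕ∞) →
            ∀ S : List (Update V),
              alg.Maintains (matroidOracle f M) f (fun I => M.Indep (I : Set V)) (4 + ε) S ∧
              alg.QueryComplexityLE (matroidOracle f M) S
                (C * (k * Real.log (k + 1) * Real.log ((k + 1) / ε) ^ 3))) ∧
    -- cardinality constraint
    (∃ C : ℝ, 0 < C ∧
      ∀ (V : Type u) [Finite V] [DecidableEq V] (k : ℕ) (ε : ℝ), 0 < ε → ε ≤ 1 →
        ∃ alg : DynamicAlgorithm V (ValueAnswer V),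
          ∀ f : Finset V → ℝ, IsMonotoneSubmodular f →
            ∀ S : List (Update V),
              alg.Maintains f f (fun I => I.card ≤ k) (2 + ε) S ∧
              alg.QueryComplexityLE f S (C * (k * ε⁻¹ * Real.log (k + 1) ^ 2))) := by
  exact ⟨⟨15000, by norm_num, fun V _ _ k ε hε hε1 => exists_matroid_algorithm V k hε hε1⟩,
    ⟨172, by norm_num, fun V _ _ k ε hε hε1 => exists_cardinality_algorithm V k hε hε1⟩⟩
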